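/- Let $G=(A\cup B,E)$ be a bipartite graph with $|A|=|B|=n$ and $|E|=m$, in which every agent $a\in A$ has a strict partial order $\succ_a$ (an irreflexive and transitive relation) on her set of neighbors in $B$; an agent is indifferent between two neighbors that are not comparable under $\succ_a$. For perfect matchings $M,N$ of $G$, let $\phi(M,N)$ be the number of agents $a$ with $M(a)\succ_a N(a)$, where $M(a)$ is the partner of $a$ in $M$, and let $\Delta(M,N)=\phi(M,N)-\phi(N,M)$. A perfect matching $M$ of $G$ is a *popular assignment* if $\Delta(M,N)\ge 0$ for every perfect matching $N$ of $G$. The *popular assignment problem* is to decide, given $G$ and the preferences, whether $G$ admits a popular assignment, and to find one if it does. **Theorem.** The popular assignment problem can be solved by a deterministic algorithm in $O(m\cdot n^{5/2})$ time. Precisely: there are a single program $P$ for the word RAM and constants $C,k$ such that, for every instance as above with $A$ and $B$ numbered $0,\dots,n-1$, and for every word length $w$ with $2^w\ge (n+2)^k$, the program $P$ halts after at most $C\,(m\,n^{5/2}+1)$ elementary steps, and either outputs the list $M(0),\dots,M(n-1)$ of the partners of the agents in some popular assignment $M$ of $G$, or correctly reports that $G$ has no popular assignment. (The summand $1$ matters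 only if $m=0$.) The input consists of $n$, $m$, the list of the $m$ edges in arbitrary order, and a $0/1$ table in which a single look-up tells whether $b\succ_a b'$. The elementary steps, on words of $w$ bits, are: evaluating a constant, reading or writing a register or a cell of an array, addition, multiplication (both modulo $2^w$), subtraction truncated at $0$, comparison ($<$ or $=$), branching on a value, and the empty statement. -/

import Mathlib

/-! ## Popular assignments in bipartite graphs with one-sided partial-order preferences -/

namespace PopAssign

/-- A bipartite graph `(A ∪ B, E)` in which every agent `a : A` has a strict partial order
over her neighbours; `pref a b b'` means that `a` prefers `b` to `b'`. -/
structure Market (A B : Type*) where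
  /-- the edge set -/
  E : Finset (A × B)
  /-- `pref a b b'` : agent `a` prefers object `b` to object `b'` -/
  pref : A → B → B → Prop
  pref_nbr : ∀ a b b', pref a b b' → (a, b) ∈ E ∧ (a, b') ∈ E
  pref_irrefl : ∀ a b, ¬ pref a b b
  pref_trans : ∀ a b b' b'', pref a b b' → pref a b' b'' → pref a b b''

variable {A B : Type*}

/-- `M` is a matching of `G`: a set of edges no two of which share an endpoint. -/
def IsMatching (G : Market A B) (M : Finset (A × B)) : Prop :=
  M ⊆ G.E ∧ ∀ e ∈ M, ∀ f ∈ M, (e.1 = f.1 ∨ e.2 = f.2) → e = f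

/-- A perfect matching (an assignment): a matching that covers every agent and every object. -/
def IsAssignment (G : Market A B) (M : Finset (A × B)) : Prop :=
  IsMatching G M ∧ (∀ a : A, ∃ b, (a, b) ∈ M) ∧ (∀ b : B, ∃ a, (a, b) ∈ M)

/-- Agent `a` prefers the matching `M` to the matching `N`: she is matched in `M`, and either she
is unmatched in `N` or she prefers her partner in `M` to her partner in `N`. -/
def Prefers (G : Market A B) (a : A) (M N : Finset (A × B)) : Prop :=
  ∃ b, (a, b) ∈ M ∧ ∀ b', (a, b') ∈ N → G.pref a b b'

/-- The number of agents who prefer `M` to `N`. -/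
noncomputable def votes (G : Market A B) (M N : Finset (A × B)) : ℕ :=
  Set.ncard {a : A | Prefers G a M N}

/-- `Δ(M, N)`: the votes for `M` against `N` minus the votes for `N` against `M`. -/
noncomputable def margin (G : Market A B) (M N : Finset (A × B)) : ℤ :=
  (votes G M N : ℤ) - (votes G N M : ℤ)

/-- A popular assignment: a perfect matching such that no perfect matching is more popular. -/
def IsPopularAssignment (G : Market A B) (M : Finset (A × B)) : Prop :=
  IsAssignment G M ∧ ∀ N : Finset (A × B), IsAssignment G N → 0 ≤ margin G M N

end PopAssign

/-! ## A deterministic word RAM with a step count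

A machine with word length `w` has finitely many registers and finitely many arrays of words that
are addressed by words (a program names only finitely many of both). A program is a structured
program over these. Sums and products are computed modulo `2 ^ w`, so no operation ever
produces a number of more than `w` bits. -/

namespace WordRAM

/-- The contents of the registers and of the arrays. -/
structure State where
  reg : ℕ → ℕ
  arr : ℕ → ℕ → ℕ

/-- Binary operations; the comparisons return `1` for true and `0` for false. -/
inductive Op where
  | add
  | sub
  | mul
  | lt
  | eq

/-- The result of an operation on words of length `w` (subtraction is truncated at `0`). -/
def Op.eval (w : ℕ) : Op → ℕ → ℕ → ℕ
  | .add, x, y => (x + y) % 2 ^ w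
  | .sub, x, y => x - y
  | .mul, x, y => (x * y) % 2 ^ w
  | .lt, x, y => if x < y then 1 else 0
  | .eq, x, y => if x = y then 1 else 0

/-- Expressions: constants, registers, array look-ups and binary operations. -/
inductive Exp where
  | const (c : ℕ)
  | reg (r : ℕ)
  | get (a : ℕ) (i : Exp)
  | bin (o : Op) (e f : Exp)

/-- The value of an expression. -/
def Exp.eval (w : ℕ) (s : State) : Exp → ℕ
  | .const c => c % 2 ^ w
  | .reg r => s.reg r
  | .get a i => s.arr a (i.eval w s)
  | .bin o e f => o.eval w (e.eval w s) (f.eval w s)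

/-- The number of elementary steps taken to evaluate an expression: one for every constant,
every register access, every array access and every operation. -/
def Exp.cost : Exp → ℕ
  | .const _ => 1
  | .reg _ => 1
  | .get _ i => i.cost + 1
  | .bin _ e f => e.cost + f.cost + 1

/-- Programs. -/
inductive Prog where
  | skip
  | set (r : ℕ) (e : Exp)
  | store (a : ℕ) (i e : Exp)
  | seq (p q : Prog)
  | cond (e : Exp) (p q : Prog)
  | loop (e : Exp) (p : Prog)

/-- Write the value `v` into register `r`. -/
def State.setReg (s : State) (r v : ℕ) : State :=
  { s with reg := Function.update s.reg r v }

/-- Write the value `v` into cell `i` of array `a`. -/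
def State.setArr (s : State) (a i v : ℕ) : State :=
  { s with arr := Function.update s.arr a (Function.update (s.arr a) i v) }

/-- `Runs w p s t s'`: with word length `w`, the program `p` started in state `s` halts after
exactly `t` elementary steps in state `s'`. For given `w`, `p` and `s` there is at most one such
pair `t`, `s'`; there is none if the program does not halt. -/
inductive Runs (w : ℕ) : Prog → State → ℕ → State → Prop where
  | skip (s : State) : Runs w .skip s 1 s
  | set (r : ℕ) (e : Exp) (s : State) :
      Runs w (.set r e) s (e.cost + 1) (s.setReg r (e.eval w s))
  | store (a : ℕ) (i e : Exp) (s : State) :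
      Runs w (.store a i e) s (i.cost + e.cost + 1) (s.setArr a (i.eval w s) (e.eval w s))
  | seq {p q : Prog} {s s' s'' : State} {t t' : ℕ} :
      Runs w p s t s' → Runs w q s' t' s'' → Runs w (.seq p q) s (t + t') s''
  | cond_true {e : Exp} {p q : Prog} {s s' : State} {t : ℕ} :
      e.eval w s ≠ 0 → Runs w p s t s' → Runs w (.cond e p q) s (e.cost + 1 + t) s'
  | cond_false {e : Exp} {p q : Prog} {s s' : State} {t : ℕ} :
      e.eval w s = 0 → Runs w q s t s' → Runs w (.cond e p q) s (e.cost + 1 + t) s'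
  | loop_done {e : Exp} {p : Prog} {s : State} :
      e.eval w s = 0 → Runs w (.loop e p) s (e.cost + 1) s
  | loop_step {e : Exp} {p : Prog} {s s' s'' : State} {t t' : ℕ} :
      e.eval w s ≠ 0 → Runs w p s t s' → Runs w (.loop e p) s' t' s'' →
      Runs w (.loop e p) s (e.cost + 1 + t + t') s''

end WordRAM

/-! ## Input and output of the popular assignment problem -/

namespace PopAssign

open Classical in
/-- The initial state for the input `G`, whose edges are listed, in some order, in `es`.
Agents and objects are numbered `0, …, n - 1`. Register `0` holds `n` and register `1` holds the
number of edges; arrays `0` and `1` hold the agent and the object of the `i`-th edge; array `2` is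
the 0/1 table of the preferences, with the answer to `b ≻ₐ b'` in cell `(a * n + b) * n + b'`.
Everything else is `0`. -/
noncomputable def inputState {n : ℕ} (G : Market (Fin n) (Fin n)) (es : List (Fin n × Fin n)) :
    WordRAM.State where
  reg r := if r = 0 then n else if r = 1 then es.length else 0
  arr k i :=
    if k = 0 then (es[i]?).elim 0 (fun e => (e.1 : ℕ))
    else if k = 1 then (es[i]?).elim 0 (fun e => (e.2 : ℕ))
    else if k = 2 then
      if ∃ a b b' : Fin n, i = ((a : ℕ) * n + (b : ℕ)) * n + (b' : ℕ) ∧ G.pref a b b' then 1 else 0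
    else 0

/-- The final state `s` answers the popular assignment problem for `G`: either register `0`
is `1` and array `3` lists the partners of the agents in a popular assignment of `G`, or
register `0` is `0` and `G` has no popular assignment. -/
def Solves {n : ℕ} (G : Market (Fin n) (Fin n)) (s : WordRAM.State) : Prop :=
  (s.reg 0 = 1 ∧ ∃ M : Finset (Fin n × Fin n), IsPopularAssignment G M ∧
      ∀ a b : Fin n, (a, b) ∈ M ↔ s.arr 3 (a : ℕ) = (b : ℕ)) ∨
  (s.reg 0 = 0 ∧ ¬ ∃ M : Finset (Fin n × Fin n), IsPopularAssignment G M)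

end PopAssign

/-! Popularity is certified by levels on the objects. Call an edge $ab$ tight if no neighbour of $a$
beats $b$ once levels are added to the 0/1 votes. If all edges of a perfect matching are tight,
summing the tightness inequalities against any other perfect matching cancels the levels, because
both matchings use every object once; hence the matching is popular
(`isPopularAssignment_of_tight`). Conversely, if $\sigma$ is popular, consider the digraph on the
agents in which an arc $x\to y$ means that $x$ may take the object of $y$, weighted by the vote of
$x$ for that exchange. It has no positive cycle, so heaviest simple paths define a potential with
values below $n$, and this gives levels in $1,\dots,n$ for which $\sigma$ is tight
(`exists_potential`, `IsPopularAssignment.exists_isTarget`).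

The algorithm looks for such levels from below. All levels start at $0$ and stay below every target
$L$. In each round a matching of tight edges is computed that is either perfect, and then popular,
or leaves free an object $b_0$ from which no augmenting path starts. In the second case every target
satisfies $L(b_0)>\mathrm{lev}(b_0)$ (`IsTarget.lt_of_closed`), so the level of $b_0$ can be raised;
if it is already $n$, there is no target and hence no popular assignment.

There are at most $n^2+1$ rounds, and each takes $O(m\sqrt n)$ steps when $m\ge n$. An auction in
which bids stop at $K\approx\sqrt n$ costs $O(K(m+n))$ and ends within $K$ edges of a maximum
matching: averaging the $K$ vertex covers given by the price thresholds bounds the loss by $n/K\le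
K$ (`Auction.near_optimal`). At most $K$ successful breadth-first searches and one last test then
finish the round. Raising one level changes the table of tight edges in a way that takes $O(m+n)$
steps to compute (`TightTable.raise`). If $m<n$ there is no perfect matching at all. -/

namespace WordRAM

/-! ### Timed Hoare rules for the word RAM. -/

/-- A program without loops. -/
def Prog.straight : Prog → Bool
  | .skip => true
  | .set _ _ => true
  | .store _ _ _ => true
  | .seq p q => p.straight && q.straight
  | .cond _ p q => p.straight && q.straight
  | .loop _ _ => false

/-- An upper bound for the running time of a loop-free program. -/
def Prog.maxCost : Prog → ℕ
  | .skip => 1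
  | .set _ e => e.cost + 1
  | .store _ i e => i.cost + e.cost + 1
  | .seq p q => p.maxCost + q.maxCost
  | .cond e p q => e.cost + 1 + max p.maxCost q.maxCost
  | .loop _ _ => 0

/-- The final state of a loop-free program. -/
def Prog.exec (w : ℕ) : Prog → State → State
  | .skip, s => s
  | .set r e, s => s.setReg r (e.eval w s)
  | .store a i e, s => s.setArr a (i.eval w s) (e.eval w s)
  | .seq p q, s => q.exec w (p.exec w s)
  | .cond e p q, s => if e.eval w s = 0 then q.exec w s else p.exec w s
  | .loop _ _, s => s

/-- The registers that a program may write. -/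
def Prog.regs : Prog → List ℕ
  | .skip => []
  | .set r _ => [r]
  | .store _ _ _ => []
  | .seq p q => p.regs ++ q.regs
  | .cond _ p q => p.regs ++ q.regs
  | .loop _ p => p.regs

/-- The arrays that a program may write. -/
def Prog.arrs : Prog → List ℕ
  | .skip => []
  | .set _ _ => []
  | .store a _ _ => [a]
  | .seq p q => p.arrs ++ q.arrs
  | .cond _ p q => p.arrs ++ q.arrs
  | .loop _ p => p.arrs

theorem Prog.runs_exec (w : ℕ) (p : Prog) (hp : p.straight = true) (s : State) :
    ∃ t, Runs w p s t (p.exec w s) ∧ t ≤ p.maxCost := by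
  induction p generalizing s with
  | skip => exact ⟨_, .skip s, le_rfl⟩
  | set r e => exact ⟨_, .set r e s, le_rfl⟩
  | store a i e => exact ⟨_, .store a i e s, le_rfl⟩
  | seq p q ihp ihq =>
    simp only [Prog.straight, Bool.and_eq_true] at hp
    obtain ⟨t, h, ht⟩ := ihp hp.1 s
    obtain ⟨t', h', ht'⟩ := ihq hp.2 (p.exec w s)
    exact ⟨_, .seq h h', by simp only [Prog.maxCost]; omega⟩
  | cond e p q ihp ihq =>
    simp only [Prog.straight, Bool.and_eq_true] at hp
    obtain ⟨t, h, ht⟩ := ihp hp.1 s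
    obtain ⟨t', h', ht'⟩ := ihq hp.2 s
    by_cases he : e.eval w s = 0
    · refine ⟨e.cost + 1 + t', ?_, by simp only [Prog.maxCost]; omega⟩
      simpa [Prog.exec, he] using Runs.cond_false he h'
    · refine ⟨e.cost + 1 + t, ?_, by simp only [Prog.maxCost]; omega⟩
      simpa [Prog.exec, he] using Runs.cond_true he h
  | loop e p => simp [Prog.straight] at hp

/-- `s'` agrees with `s` on everything that `p` does not write. -/
structure Frame (p : Prog) (s s' : State) : Prop where
  reg : ∀ r, r ∉ p.regs → s'.reg r = s.reg r
  arr : ∀ a, a ∉ p.arrs → s'.arr a = s.arr a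

theorem Frame.refl (p : Prog) (s : State) : Frame p s s := ⟨fun _ _ => rfl, fun _ _ => rfl⟩

theorem Frame.trans {p : Prog} {s s' s'' : State} (h : Frame p s s') (h' : Frame p s' s'') :
    Frame p s s'' :=
  ⟨fun r hr => (h'.reg r hr).trans (h.reg r hr), fun a ha => (h'.arr a ha).trans (h.arr a ha)⟩

theorem Frame.mono {p q : Prog} {s s' : State} (h : Frame p s s')
    (hr : p.regs ⊆ q.regs) (ha : p.arrs ⊆ q.arrs) : Frame q s s' :=
  ⟨fun r h' => h.reg r fun h'' => h' (hr h''), fun a h' => h.arr a fun h'' => h' (ha h'')⟩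

theorem Runs.frame {w : ℕ} {p : Prog} {s s' : State} {t : ℕ} (h : Runs w p s t s') :
    Frame p s s' := by
  induction h with
  | skip s => exact .refl _ _
  | set r e s =>
    refine ⟨fun x hx => ?_, fun _ _ => rfl⟩
    simp only [Prog.regs, List.mem_singleton] at hx
    simp [State.setReg, hx]
  | store a i e s =>
    refine ⟨fun _ _ => rfl, fun x hx => ?_⟩
    simp only [Prog.arrs, List.mem_singleton] at hx
    simp [State.setArr, hx]
  | seq _ _ h h' =>
    exact (h.mono (by simp [Prog.regs]) (by simp [Prog.arrs])).trans
      (h'.mono (by simp [Prog.regs]) (by simp [Prog.arrs]))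
  | cond_true _ _ h => exact h.mono (by simp [Prog.regs]) (by simp [Prog.arrs])
  | cond_false _ _ h => exact h.mono (by simp [Prog.regs]) (by simp [Prog.arrs])
  | loop_done => exact .refl _ _
  | loop_step _ _ _ h h' =>
    exact Frame.trans (h.mono (by simp [Prog.regs]) (by simp [Prog.arrs])) h'

/-- Started in `s`, the program `p` halts within `T` steps in a state that satisfies `Q`. -/
def Does (w : ℕ) (p : Prog) (s : State) (T : ℕ) (Q : State → Prop) : Prop :=
  ∃ t s', Runs w p s t s' ∧ t ≤ T ∧ Q s'

namespace Does

variable {w : ℕ} {p q : Prog} {e : Exp} {s : State} {T T' : ℕ} {Q Q' : State → Prop}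

/-- Besides weakening the time bound, this lets the new postcondition use that whatever `p` does not
write is unchanged. -/
theorem mono (h : Does w p s T Q) (hT : T ≤ T') (hQ : ∀ s', Frame p s s' → Q s' → Q' s') :
    Does w p s T' Q' := by
  obtain ⟨t, s', hr, ht, hq⟩ := h
  exact ⟨t, s', hr, ht.trans hT, hQ s' hr.frame hq⟩

theorem straight (hp : p.straight = true) (hQ : Q (p.exec w s)) : Does w p s p.maxCost Q := by
  obtain ⟨t, h, ht⟩ := p.runs_exec w hp s
  exact ⟨t, _, h, ht, hQ⟩

theorem seq (h : Does w p s T Q) (h' : ∀ s', Frame p s s' → Q s' → Does w q s' T' Q') :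
    Does w (.seq p q) s (T + T') Q' := by
  obtain ⟨t, s', hr, ht, hq⟩ := h
  obtain ⟨t', s'', hr', ht', hq'⟩ := h' s' hr.frame hq
  exact ⟨_, s'', .seq hr hr', by omega, hq'⟩

theorem cond (h : e.eval w s ≠ 0 → Does w p s T Q) (h' : e.eval w s = 0 → Does w q s T' Q) :
    Does w (.cond e p q) s (e.cost + 1 + max T T') Q := by
  by_cases he : e.eval w s = 0
  · obtain ⟨t, s', hr, ht, hq⟩ := h' he
    exact ⟨_, s', .cond_false he hr, by omega, hq⟩
  · obtain ⟨t, s', hr, ht, hq⟩ := h he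
    exact ⟨_, s', .cond_true he hr, by omega, hq⟩

theorem straight_seq (hp : p.straight = true)
    (h : ∀ s', Frame p s s' → s' = p.exec w s → Does w q s' T Q) :
    Does w (.seq p q) s (p.maxCost + T) Q :=
  (straight (Q := fun s' => s' = p.exec w s) hp rfl).seq h

/-- The potential `Φ` drops in every iteration, so there are at most `N` of them, each costing `c`
plus the guard. The frame from `s₀` is carried along, so that `I` need not mention the cells that
the body leaves alone. -/
theorem loop {s₀ : State} {c : ℕ} (N : ℕ) (I : State → Prop) (Φ : State → ℕ) (h₀ : I s₀)
    (hN : Φ s₀ ≤ N) (hstep : ∀ s, Frame p s₀ s → I s → e.eval w s ≠ 0 →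
      Does w p s c (fun s' => I s' ∧ Φ s' < Φ s)) :
    Does w (.loop e p) s₀ (N * (c + e.cost + 1) + e.cost + 1)
      (fun s' => I s' ∧ e.eval w s' = 0) := by
  suffices H : ∀ N, ∀ s, Φ s ≤ N → Frame p s₀ s → I s →
      Does w (.loop e p) s (N * (c + e.cost + 1) + e.cost + 1)
        (fun s' => I s' ∧ e.eval w s' = 0) from H _ s₀ hN (.refl _ _) h₀
  intro N
  induction N with
  | zero =>
    intro s hs hf hI
    by_cases he : e.eval w s = 0
    · exact ⟨_, s, .loop_done he, by omega, hI, he⟩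
    · obtain ⟨_, _, _, _, _, h⟩ := hstep s hf hI he
      omega
  | succ N ih =>
    intro s hs hf hI
    by_cases he : e.eval w s = 0
    · exact ⟨_, s, .loop_done he, by omega, hI, he⟩
    · obtain ⟨t, s', hr, ht, hI', h⟩ := hstep s hf hI he
      obtain ⟨t', s'', hr', ht', hQ⟩ := ih s' (by omega) (hf.trans hr.frame) hI'
      refine ⟨_, s'', .loop_step he hr hr', ?_, hQ⟩
      rw [Nat.succ_mul]
      omega

/-- A loop with a loop-free body. -/
theorem loop_straight {s₀ : State} (hp : p.straight = true) (N : ℕ) (I : State → Prop)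
    (Φ : State → ℕ) (h₀ : I s₀) (hN : Φ s₀ ≤ N) (hstep : ∀ s, Frame p s₀ s → I s →
      e.eval w s ≠ 0 → I (p.exec w s) ∧ Φ (p.exec w s) < Φ s) :
    Does w (.loop e p) s₀ (N * (p.maxCost + e.cost + 1) + e.cost + 1)
      (fun s' => I s' ∧ e.eval w s' = 0) :=
  loop N I Φ h₀ hN fun s hf hI he => straight hp (hstep s hf hI he)

end Does

@[simp] theorem State.setReg_reg (s : State) (r v r' : ℕ) :
    (s.setReg r v).reg r' = if r' = r then v else s.reg r' := by
  simp [State.setReg, Function.update_apply]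

@[simp] theorem State.setReg_arr (s : State) (r v : ℕ) : (s.setReg r v).arr = s.arr := rfl

@[simp] theorem State.setArr_reg (s : State) (a i v : ℕ) : (s.setArr a i v).reg = s.reg := rfl

@[simp] theorem State.setArr_arr (s : State) (a i v a' : ℕ) :
    (s.setArr a i v).arr a' = if a' = a then Function.update (s.arr a) i v else s.arr a' := by
  by_cases h : a' = a
  · subst h; simp [State.setArr]
  · simp [State.setArr, h]

end WordRAM

namespace PopAssign

/-! ### Matchings and adjacency lists stored in arrays. -/

/-- The arrays `deg` and `nbr` list, for every object, its possible neighbours; the table `ok`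
selects the edges of a bipartite graph among the listed pairs. -/
structure AdjLists (n m : ℕ) (deg nbr ok : ℕ → ℕ) : Prop where
  nbr_lt : ∀ b < n, ∀ j < deg b, nbr (b * m + j) < n
  listed : ∀ a < n, ∀ b < n, ok (a * n + b) ≠ 0 → ∃ j < deg b, nbr (b * m + j) = a
  deg_sum : ∑ b ∈ Finset.range n, deg b = m

/-- The arrays `mA` and `mB` hold the partners in a matching of the graph `ok`; the entry `n`
stands for an unmatched vertex. -/
structure MatchArrays (n : ℕ) (ok mA mB : ℕ → ℕ) : Prop where
  agent : ∀ a < n, mA a ≠ n → mA a < n ∧ mB (mA a) = a ∧ ok (a * n + mA a) ≠ 0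
  object : ∀ b < n, mB b ≠ n → mB b < n ∧ mA (mB b) = b

/-- The number of entries `n` among the first `n` entries of `f`. -/
def freeCount (n : ℕ) (f : ℕ → ℕ) : ℕ := ((Finset.range n).filter fun b => f b = n).card

theorem freeCount_le (n : ℕ) (f : ℕ → ℕ) : freeCount n f ≤ n :=
  (Finset.card_filter_le _ _).trans (by simp)

/-- All potentials below are sums over cells, and a step of a program changes one cell; this turns
the local decrease into a global one. -/
theorem sum_update_lt {n x v : ℕ} {f : ℕ → ℕ} (hx : x < n) (g : ℕ → ℕ → ℕ)
    (h : g x v < g x (f x)) :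
    ∑ i ∈ Finset.range n, g i (Function.update f x v i) < ∑ i ∈ Finset.range n, g i (f i) := by
  refine Finset.sum_lt_sum (fun i _ => ?_) ⟨x, by simpa using hx, by simpa using h⟩
  rcases eq_or_ne i x with rfl | hi
  · simpa using h.le
  · simp [hi]

theorem freeCount_update {n x v : ℕ} {f : ℕ → ℕ} (hx : x < n) (hf : f x = n) (hv : v ≠ n) :
    freeCount n (Function.update f x v) + 1 = freeCount n f := by
  have : (Finset.range n).filter (fun b => Function.update f x v b = n) =
      ((Finset.range n).filter fun b => f b = n).erase x := by
    ext b
    rcases eq_or_ne b x with rfl | hb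
    · simp [hv]
    · simp [hb]
  rw [freeCount, this, freeCount, Finset.card_erase_add_one (by simp [hx, hf])]

theorem freeCount_congr {n : ℕ} {f g : ℕ → ℕ} (h : ∀ b < n, f b = n ↔ g b = n) :
    freeCount n f = freeCount n g := by
  unfold freeCount
  congr 1
  exact Finset.filter_congr fun b hb => h b (by simpa using hb)

namespace MatchArrays

variable {n : ℕ} {ok mA mB : ℕ → ℕ}

/-- Matching a free object `b` to an agent `a`, which displaces the partner of `a`, if any. -/
theorem rematch (h : MatchArrays n ok mA mB) {a b : ℕ} (ha : a < n) (hb : b < n)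
    (hab : ok (a * n + b) ≠ 0) (hfree : mB b = n) :
    MatchArrays n ok (Function.update mA a b)
      (Function.update (Function.update mB (mA a) n) b a) := by
  constructor
  · intro x hx hxn
    rcases eq_or_ne x a with rfl | hxa
    · simpa [hb] using hab
    · rw [Function.update_of_ne hxa] at hxn ⊢
      obtain ⟨h1, h2, h3⟩ := h.agent x hx hxn
      have hne : mA x ≠ b := by rintro hb'; rw [hb', hfree] at h2; omega
      have hne' : mA x ≠ mA a := by
        intro he
        have := (h.agent a ha (he ▸ hxn)).2.1
        rw [← he, h2] at this
        exact hxa this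
      rw [Function.update_of_ne hne, Function.update_of_ne hne']
      exact ⟨h1, h2, h3⟩
  · intro y hy hyn
    rcases eq_or_ne y b with rfl | hyb
    · simpa using ha
    · rw [Function.update_of_ne hyb] at hyn ⊢
      have hy' : y ≠ mA a := by rintro rfl; simp at hyn
      rw [Function.update_of_ne hy'] at hyn ⊢
      obtain ⟨h1, h2⟩ := h.object y hy hyn
      have : mB y ≠ a := by rintro he; exact hy' (by rw [← he, h2])
      rw [Function.update_of_ne this]
      exact ⟨h1, h2⟩

/-- Exchanging the partner of a matched object `b` for a free agent `a`. -/
theorem shift (h : MatchArrays n ok mA mB) {a b : ℕ} (ha : a < n) (hb : b < n)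
    (hab : ok (a * n + b) ≠ 0) (hfree : mA a = n) :
    MatchArrays n ok (Function.update (Function.update mA (mB b) n) a b)
      (Function.update mB b a) := by
  constructor
  · intro x hx hxn
    rcases eq_or_ne x a with rfl | hxa
    · simpa [hb] using hab
    · rw [Function.update_of_ne hxa] at hxn ⊢
      have hx' : x ≠ mB b := by rintro rfl; simp at hxn
      rw [Function.update_of_ne hx'] at hxn ⊢
      obtain ⟨h1, h2, h3⟩ := h.agent x hx hxn
      have : mA x ≠ b := by rintro he; exact hx' (by rw [← he, h2])
      rw [Function.update_of_ne this]
      exact ⟨h1, h2, h3⟩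
  · intro y hy hyn
    rcases eq_or_ne y b with rfl | hyb
    · simpa using ha
    · rw [Function.update_of_ne hyb] at hyn ⊢
      obtain ⟨h1, h2⟩ := h.object y hy hyn
      have hne : mB y ≠ a := by rintro he; rw [he, hfree] at h2; omega
      have hne' : mB y ≠ mB b := by
        intro he
        have := (h.object b hb (he ▸ hyn)).2
        rw [← he, h2] at this
        exact hyb this
      rw [Function.update_of_ne hne, Function.update_of_ne hne']
      exact ⟨h1, h2⟩

end MatchArrays

/-! ### The auction for a nearly maximum matching. -/

/-- The invariant of the auction: `p a` is the price of agent `a` and `d b` the current bid of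
object `b`, whose list has been searched up to `ptr b`. The objects from `q` on have not bid yet,
the object `cur` (if it is not `n`) is bidding. -/
structure Auction (n m K : ℕ) (deg nbr ok mA mB p d ptr : ℕ → ℕ) (q cur : ℕ) : Prop where
  mat : MatchArrays n ok mA mB
  q_le : q ≤ n
  cur_le : cur ≤ n
  cur_lt : cur < n → cur < q ∧ mB cur = n ∧ d cur < K
  price_free : ∀ a < n, mA a = n → p a = 0
  price_eq : ∀ b < n, mB b ≠ n → p (mB b) = d b + 1
  price_ge : ∀ a < n, ∀ b < n, ok (a * n + b) ≠ 0 → d b ≤ p a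
  price_gt : ∀ b < n, ∀ j < ptr b, j < deg b → ok (nbr (b * m + j) * n + b) ≠ 0 →
    d b < p (nbr (b * m + j))
  bid_free : ∀ b < q, b ≠ cur → mB b = n → K ≤ d b
  untouched : ∀ b, q ≤ b → b < n → mB b = n ∧ d b = 0
  bid_le : ∀ b < n, d b ≤ K
  price_le : ∀ a < n, p a ≤ K
  ptr_le : ∀ b < n, ptr b ≤ deg b

/-- The potential of the auction. -/
def auctionPotential (n K : ℕ) (deg p d ptr : ℕ → ℕ) (q : ℕ) : ℕ :=
  ∑ b ∈ Finset.range n, (K * (deg b + 1) - (d b * (deg b + 1) + ptr b)) +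
    ∑ a ∈ Finset.range n, (K - p a) + (n - q)

namespace Auction

variable {n m K : ℕ} {deg nbr ok mA mB p d ptr : ℕ → ℕ} {q cur : ℕ}

theorem start (hmA : ∀ a < n, mA a = n) (hmB : ∀ b < n, mB b = n) (hp : ∀ a < n, p a = 0)
    (hd : ∀ b < n, d b = 0) (hptr : ∀ b < n, ptr b = 0) :
    Auction n m K deg nbr ok mA mB p d ptr 0 n where
  mat := ⟨fun a ha h => absurd (hmA a ha) h, fun b hb h => absurd (hmB b hb) h⟩
  q_le := by omega
  cur_le := le_rfl
  cur_lt := by omega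
  price_free a ha _ := hp a ha
  price_eq b hb h := absurd (hmB b hb) h
  price_ge a ha b hb _ := by simp [hd b hb]
  price_gt b hb j hj := by simp [hptr b hb] at hj
  bid_free := by omega
  untouched b _ hb := ⟨hmB b hb, hd b hb⟩
  bid_le b hb := by simp [hd b hb]
  price_le a ha := by simp [hp a ha]
  ptr_le b hb := by simp [hptr b hb]

theorem next (h : Auction n m K deg nbr ok mA mB p d ptr q n) (hq : q < n) (hK : n ≤ K * K) :
    Auction n m K deg nbr ok mA mB p d ptr (q + 1) q :=
  { h with
    q_le := hq
    cur_le := hq.le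
    cur_lt := fun _ => ⟨by omega, (h.untouched q le_rfl hq).1, by
      rw [(h.untouched q le_rfl hq).2]
      -- A new bidder starts at bid $0$, which must be below the cap; $K=0$ is impossible since
      -- $q<n\le K^2$.
      rcases Nat.eq_zero_or_pos K with rfl | h0 <;> omega⟩
    bid_free := fun b hb hbq => h.bid_free b (by omega) (by omega)
    untouched := fun b hb => h.untouched b (by omega) }

theorem next_potential (hq : q < n) :
    auctionPotential n K deg p d ptr (q + 1) < auctionPotential n K deg p d ptr q := by
  unfold auctionPotential; omega

theorem skip (h : Auction n m K deg nbr ok mA mB p d ptr q cur) (hc : cur < n)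
    (hj : ptr cur < deg cur)
    (hs : ok (nbr (cur * m + ptr cur) * n + cur) = 0 ∨ d cur < p (nbr (cur * m + ptr cur))) :
    Auction n m K deg nbr ok mA mB p d (Function.update ptr cur (ptr cur + 1)) q cur :=
  { h with
    price_gt := by
      intro b hb j hjp hjd hok
      rcases eq_or_ne b cur with rfl | hbc
      · rw [Function.update_self] at hjp
        rcases Nat.lt_succ_iff_lt_or_eq.mp hjp with hlt | rfl
        · exact h.price_gt b hb j hlt hjd hok
        · exact hs.resolve_left hok
      · rw [Function.update_of_ne hbc] at hjp
        exact h.price_gt b hb j hjp hjd hok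
    ptr_le := by
      intro b hb
      rcases eq_or_ne b cur with rfl | hbc
      · simpa using hj
      · simpa [hbc] using h.ptr_le b hb }

/-- The progress of an object is the pair (bid, list position), ordered lexicographically and
encoded in base `k + 1` with `k` the length of its list. -/
theorem level_lt {e k P : ℕ} (hd : e < K) (hp : P ≤ k) : e * (k + 1) + P < K * (k + 1) := by
  have : (e + 1) * (k + 1) ≤ K * (k + 1) := Nat.mul_le_mul_right _ hd
  rw [Nat.succ_mul] at this
  omega

theorem skip_potential (h : Auction n m K deg nbr ok mA mB p d ptr q cur) (hc : cur < n)
    (hj : ptr cur < deg cur) :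
    auctionPotential n K deg p d (Function.update ptr cur (ptr cur + 1)) q <
      auctionPotential n K deg p d ptr q := by
  have hl := level_lt (h.cur_lt hc).2.2 hj
  have := sum_update_lt (f := ptr) (v := ptr cur + 1) hc
    (fun b P => K * (deg b + 1) - (d b * (deg b + 1) + P)) (by omega)
  unfold auctionPotential
  omega

/-- When the list is exhausted, `price_gt` says that every neighbour costs more than the current
bid. Raising the bid by one therefore preserves `price_ge`, and the scan restarts. At the cap the
object drops out, which is encoded by `cur = n`. -/
theorem bid (hA : AdjLists n m deg nbr ok) (h : Auction n m K deg nbr ok mA mB p d ptr q cur)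
    (hc : cur < n) (hj : deg cur ≤ ptr cur) :
    Auction n m K deg nbr ok mA mB p (Function.update d cur (d cur + 1))
      (Function.update ptr cur 0) q (if d cur + 1 < K then cur else n) := by
  obtain ⟨hq, hfree, hd⟩ := h.cur_lt hc
  have key : ∀ b, b ≠ cur → Function.update d cur (d cur + 1) b = d b := fun b hb => by simp [hb]
  refine { h with cur_le := by split_ifs <;> omega, cur_lt := ?_, price_eq := ?_, price_ge := ?_, price_gt := ?_, bid_free := ?_, untouched := ?_, bid_le := ?_, ptr_le := ?_ }
  · intro hlt
    have hK : d cur + 1 < K := by by_contra hK; simp [hK] at hlt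
    simp [hK, hq, hfree]
  · intro b hb hbn
    have : b ≠ cur := by rintro rfl; exact hbn hfree
    simpa [this] using h.price_eq b hb hbn
  · intro a ha b hb hok
    rcases eq_or_ne b cur with rfl | hbc
    · obtain ⟨j, hjd, rfl⟩ := hA.listed a ha b hb hok
      simpa using h.price_gt b hb j (by omega) hjd hok
    · simpa [hbc] using h.price_ge a ha b hb hok
  · intro b hb j hjp hjd hok
    rcases eq_or_ne b cur with rfl | hbc
    · simp at hjp
    · rw [key b hbc]
      rw [Function.update_of_ne hbc] at hjp
      exact h.price_gt b hb j hjp hjd hok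
  · intro b hb hbc hbn
    rcases eq_or_ne b cur with rfl | hbc'
    · by_cases hK : d b + 1 < K
      · simp [hK] at hbc
      · simp; omega
    · rw [key b hbc']; exact h.bid_free b hb hbc' hbn
  · intro b hb hbn
    rw [key b (by omega)]; exact h.untouched b hb hbn
  · intro b hb
    rcases eq_or_ne b cur with rfl | hbc
    · simpa using hd
    · simpa [hbc] using h.bid_le b hb
  · intro b hb
    rcases eq_or_ne b cur with rfl | hbc
    · simp
    · simpa [hbc] using h.ptr_le b hb

theorem bid_potential (h : Auction n m K deg nbr ok mA mB p d ptr q cur) (hc : cur < n)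
    (hj : deg cur ≤ ptr cur) :
    auctionPotential n K deg p (Function.update d cur (d cur + 1)) (Function.update ptr cur 0) q <
      auctionPotential n K deg p d ptr q := by
  have hd := (h.cur_lt hc).2.2
  have hl := level_lt hd (h.ptr_le cur hc)
  have hp := h.ptr_le cur hc
  unfold auctionPotential
  have : ∑ b ∈ Finset.range n, (K * (deg b + 1) -
        (Function.update d cur (d cur + 1) b * (deg b + 1) + Function.update ptr cur 0 b)) <
      ∑ b ∈ Finset.range n, (K * (deg b + 1) - (d b * (deg b + 1) + ptr b)) := by
    refine Finset.sum_lt_sum (fun i _ => ?_) ⟨cur, by simpa using hc, ?_⟩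
    · rcases eq_or_ne i cur with rfl | hi
      · simp only [Function.update_self, Nat.succ_mul]; omega
      · simp [hi]
    · simp only [Function.update_self, Nat.succ_mul]; omega
  omega

/-- The displaced partner of `a`, or `n` if there is none, becomes the bidder. Its own scan can
continue where it stopped, because prices only rise; its bid was one less than the old price of `a`,
hence below the cap. -/
theorem take (h : Auction n m K deg nbr ok mA mB p d ptr q cur)
    (hc : cur < n) {a : ℕ} (ha : a < n) (hok : ok (a * n + cur) ≠ 0) (hp : p a ≤ d cur) :
    Auction n m K deg nbr ok (Function.update mA a cur)
      (Function.update (Function.update mB (mA a) n) cur a)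
      (Function.update p a (d cur + 1)) d ptr q (mA a) := by
  obtain ⟨hq, hfree, hd⟩ := h.cur_lt hc
  have hpa : ∀ x, p x ≤ Function.update p a (d cur + 1) x := fun x => by
    rcases eq_or_ne x a with rfl | hx
    · simp; omega
    · simp [hx]
  have hmA : mA a ≠ n → mA a < n ∧ mB (mA a) = a ∧ mA a ≠ cur := fun hne => by
    obtain ⟨h1, h2, h3⟩ := h.mat.agent a ha hne
    exact ⟨h1, h2, by rintro he; rw [he, hfree] at h2; omega⟩
  have hle : mA a ≤ n := by
    by_cases hne : mA a = n
    · omega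
    · exact (hmA hne).1.le
  refine { h with mat := h.mat.rematch ha hc hok hfree, cur_le := hle, cur_lt := ?_, price_free := ?_, price_eq := ?_, price_ge := ?_, price_gt := ?_, bid_free := ?_, untouched := ?_, price_le := ?_ }
  · intro hlt
    obtain ⟨h1, h2, h3⟩ := hmA hlt.ne
    have hpe := h.price_eq (mA a) hlt (by omega)
    rw [h2] at hpe
    have hlq : mA a < q := by
      by_contra hge
      have := (h.untouched (mA a) (by omega) hlt).1
      omega
    refine ⟨hlq, by simp [h3], ?_⟩
    omega
  · intro x hx hxn
    rcases eq_or_ne x a with rfl | hxa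
    · simp at hxn; omega
    · rw [Function.update_of_ne hxa] at hxn ⊢
      exact h.price_free x hx hxn
  · intro b hb hbn
    rcases eq_or_ne b cur with rfl | hbc
    · simp
    · rw [Function.update_of_ne hbc] at hbn ⊢
      have hb' : b ≠ mA a := by rintro rfl; simp at hbn
      rw [Function.update_of_ne hb'] at hbn ⊢
      have : mB b ≠ a := by rintro rfl; exact hb' (h.mat.object b hb hbn).2.symm
      rw [Function.update_of_ne this]
      exact h.price_eq b hb hbn
  · exact fun x hx b hb hxb => (h.price_ge x hx b hb hxb).trans (hpa x)
  · exact fun b hb j hj hjd hj' => (h.price_gt b hb j hj hjd hj').trans_le (hpa _)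
  · intro b hb hba hbn
    rcases eq_or_ne b cur with rfl | hbc
    · simp at hbn; omega
    · rw [Function.update_of_ne hbc, Function.update_of_ne hba] at hbn
      exact h.bid_free b hb hbc hbn
  · intro b hqb hb
    have hbc : b ≠ cur := by omega
    obtain ⟨h1, h2⟩ := h.untouched b hqb hb
    refine ⟨?_, h2⟩
    rw [Function.update_of_ne hbc]
    rcases eq_or_ne b (mA a) with rfl | hb'
    · simp
    · rwa [Function.update_of_ne hb']
  · intro x hx
    rcases eq_or_ne x a with rfl | hxa
    · simpa using hd
    · simpa [hxa] using h.price_le x hx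

theorem take_potential (h : Auction n m K deg nbr ok mA mB p d ptr q cur) (hc : cur < n)
    {a : ℕ} (ha : a < n) (hp : p a ≤ d cur) :
    auctionPotential n K deg (Function.update p a (d cur + 1)) d ptr q <
      auctionPotential n K deg p d ptr q := by
  have hd := (h.cur_lt hc).2.2
  have := sum_update_lt (f := p) (v := d cur + 1) ha (fun _ x => K - x) (by omega)
  unfold auctionPotential
  omega

/-- An object scans its list at most `K` times, which sums to $K(m+n)$ including the bids; prices
rise at most $nK$ times; at most $n$ objects enter. -/
theorem potential_le (hA : AdjLists n m deg nbr ok) (q : ℕ) :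
    auctionPotential n K deg p d ptr q ≤ K * (m + 2 * n) + n := by
  have h1 : ∑ b ∈ Finset.range n, (K * (deg b + 1) - (d b * (deg b + 1) + ptr b)) ≤
      K * (m + n) := by
    refine (Finset.sum_le_sum fun b _ => Nat.sub_le _ _).trans ?_
    rw [← Finset.mul_sum, Finset.sum_add_distrib, hA.deg_sum]
    simp
  have h2 : ∑ a ∈ Finset.range n, (K - p a) ≤ n * K := by
    refine (Finset.sum_le_sum fun b _ => Nat.sub_le _ _).trans ?_
    simp
  unfold auctionPotential
  nlinarith [Nat.sub_le n q]

/-- When the auction is over, the matching is within `K` edges of a maximum one. -/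
theorem near_optimal (hK : n ≤ K * K)
    (h : Auction n m K deg nbr ok mA mB p d ptr n n) {mA' mB' : ℕ → ℕ}
    (h' : MatchArrays n ok mA' mB') : freeCount n mB ≤ freeCount n mB' + K := by
  classical
  let R := Finset.range n
  have hcount : ∀ f : ℕ → ℕ, freeCount n f + (R.filter fun b => f b ≠ n).card = n := fun f => by
    have := Finset.card_filter_add_card_filter_not (s := R) (fun b => f b = n)
    simpa [R, freeCount] using this
  have hfree : ∀ b < n, mB b = n → K ≤ d b := fun b hb => h.bid_free b hb hb.ne
  -- the vertex cover for the threshold `t + 1`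
  have cover : ∀ t < K, (R.filter fun b => mB' b ≠ n).card ≤
      (R.filter fun b => mB b ≠ n).card + (R.filter fun b => d b = t).card := by
    intro t ht
    -- By `price_ge` each edge has an object of bid at most $t$ or an agent of price above $t$, so
    -- these vertices form a cover and bound the size of any matching.
    have s1 : (R.filter fun b => mB' b ≠ n).card ≤
        (R.filter fun b => d b ≤ t).card + (R.filter fun a => t < p a).card := by
      have : (R.filter fun b => mB' b ≠ n) ⊆
          (R.filter fun b => d b ≤ t) ∪ (R.filter fun b => mB' b ≠ n ∧ t < p (mB' b)) := by
        intro b hb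
        simp only [R, Finset.mem_filter, Finset.mem_range, Finset.mem_union] at hb ⊢
        obtain ⟨h1, h2⟩ := h'.object b hb.1 hb.2
        have h3 := (h'.agent _ h1 (by omega)).2.2
        rw [h2] at h3
        have := h.price_ge _ h1 b hb.1 h3
        by_cases hdt : d b ≤ t
        · exact .inl ⟨hb.1, hdt⟩
        · exact .inr ⟨hb.1, hb.2, by omega⟩
      refine (Finset.card_le_card this).trans ((Finset.card_union_le _ _).trans ?_)
      refine Nat.add_le_add_left (Finset.card_le_card_of_injOn mB' ?_ ?_) _
      · intro b hb
        simp only [R, Finset.coe_filter, Finset.mem_range, Set.mem_ofPred_eq] at hb ⊢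
        exact ⟨(h'.object b hb.1 hb.2.1).1, hb.2.2⟩
      · intro b hb c hc hbc
        simp only [R, Finset.coe_filter, Finset.mem_range, Set.mem_ofPred_eq] at hb hc
        rw [← (h'.object b hb.1 hb.2.1).2, hbc, (h'.object c hc.1 hc.2.1).2]
    -- An agent of positive price is matched, and its price exceeds the bid of its partner by
    -- exactly one.
    have s2 : (R.filter fun a => t < p a).card ≤ (R.filter fun b => mB b ≠ n ∧ t ≤ d b).card := by
      have hm : ∀ a < n, t < p a → mA a ≠ n := fun a ha hp he => by
        have := h.price_free a ha he; omega
      refine Finset.card_le_card_of_injOn mA ?_ ?_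
      · intro a ha
        simp only [R, Finset.coe_filter, Finset.mem_range, Set.mem_ofPred_eq] at ha ⊢
        obtain ⟨h1, h2, _⟩ := h.mat.agent a ha.1 (hm a ha.1 ha.2)
        have := h.price_eq _ h1 (by omega)
        rw [h2] at this
        exact ⟨h1, by omega, by omega⟩
      · intro a ha c hc hac
        simp only [R, Finset.coe_filter, Finset.mem_range, Set.mem_ofPred_eq] at ha hc
        rw [← (h.mat.agent a ha.1 (hm a ha.1 ha.2)).2.1, hac,
          (h.mat.agent c hc.1 (hm c hc.1 hc.2)).2.1]
    -- Objects with bid at most $t<K$ are matched, so both sets lie among the matched objects; they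
    -- overlap only in bid exactly $t$.
    have s3 : (R.filter fun b => d b ≤ t).card + (R.filter fun b => mB b ≠ n ∧ t ≤ d b).card ≤
        (R.filter fun b => mB b ≠ n).card + (R.filter fun b => d b = t).card := by
      rw [← Finset.card_union_add_card_inter]
      refine Nat.add_le_add (Finset.card_le_card ?_) (Finset.card_le_card ?_)
      · intro b hb
        simp only [R, Finset.mem_filter, Finset.mem_range, Finset.mem_union] at hb ⊢
        rcases hb with hb | hb
        · exact ⟨hb.1, fun he => by have := hfree b hb.1 he; omega⟩
        · exact ⟨hb.1, hb.2.1⟩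
      · intro b hb
        simp only [R, Finset.mem_filter, Finset.mem_range, Finset.mem_inter] at hb ⊢
        exact ⟨hb.1.1, by omega⟩
    omega
  -- The error terms of different thresholds count disjoint sets of objects, so all $K$ of them
  -- together cost at most $n\le K^2$.
  have hsum : ∑ t ∈ Finset.range K, (R.filter fun b => d b = t).card ≤ n := by
    rw [← Finset.card_biUnion]
    · refine (Finset.card_le_card (t := R) fun b hb => ?_).trans (by simp [R])
      simp only [Finset.mem_biUnion, Finset.mem_filter] at hb
      exact hb.choose_spec.2.1
    · intro s _ t _ hst
      refine Finset.disjoint_left.mpr fun b hb hb' => hst ?_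
      simp only [Finset.mem_filter] at hb hb'
      rw [← hb.2, hb'.2]
  have htot : K * (R.filter fun b => mB' b ≠ n).card ≤
      K * (R.filter fun b => mB b ≠ n).card + n := by
    have := Finset.sum_le_sum fun t ht => cover t (Finset.mem_range.mp ht)
    rw [Finset.sum_add_distrib] at this
    simp only [Finset.sum_const, Finset.card_range, smul_eq_mul] at this
    omega
  have h1 := hcount mB
  have h2 := hcount mB'
  rcases Nat.eq_zero_or_pos K with rfl | hK0
  · omega
  · have : (R.filter fun b => mB' b ≠ n).card ≤ (R.filter fun b => mB b ≠ n).card + K := by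
      refine Nat.le_of_mul_le_mul_left ?_ hK0
      rw [Nat.mul_add]; omega
    omega

end Auction
-- Breadth-first search and augmentation.
/-- Every discovered agent `a` (one with `par a ≠ n`) is joined by an edge to the object `par a`,
which is the root `b₀` or is matched to an agent of smaller rank. -/
def SearchTree (n : ℕ) (ok mB par rk : ℕ → ℕ) (b₀ a : ℕ) : Prop :=
  par a < n ∧ ok (a * n + par a) ≠ 0 ∧
    (par a ≠ b₀ → mB (par a) < n ∧ par (mB (par a)) ≠ n ∧ rk (mB (par a)) < rk a)

/-- The invariant of the breadth-first search from the free object `b₀`. -/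
structure Search (n m : ℕ) (deg nbr ok mA mB : ℕ → ℕ) (b₀ : ℕ) (par ptr queue : ℕ → ℕ)
    (head tail found : ℕ) : Prop where
  tail_pos : 0 < tail
  root : queue 0 = b₀
  queue_lt : ∀ i < tail, queue i < n
  head_le : head ≤ tail
  -- The rank exists only in the proof, as no array stores it. Its bound, the number of discovered
  -- agents, makes a new agent outrank all older ones and later bounds the length of the path.
  tree : ∃ rk : ℕ → ℕ, ∀ a < n, par a ≠ n →
    rk a + freeCount n par ≤ n ∧ SearchTree n ok mB par rk b₀ a
  -- Every discovered agent has put one object in the queue, in addition to the root.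
  tail_eq : found = n → tail + freeCount n par = n + 1
  visited : found = n → ∀ a < n, par a ≠ n → mA a ≠ n ∧ ∃ i < tail, queue i = mA a
  queue_par : ∀ i < tail, queue i = b₀ ∨ (mB (queue i) < n ∧ par (mB (queue i)) ≠ n)
  ptr_le : ∀ b < n, ptr b ≤ deg b
  scanned : ∀ b < n, ∀ j < ptr b, ok (nbr (b * m + j) * n + b) ≠ 0 → par (nbr (b * m + j)) ≠ n
  done : ∀ i < head, deg (queue i) ≤ ptr (queue i)
  found_free : found ≠ n → found < n ∧ mA found = n ∧ par found ≠ n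

/-- The potential of the breadth-first search. -/
def searchPotential (n : ℕ) (deg ptr par : ℕ → ℕ) (head tail : ℕ) : ℕ :=
  ∑ b ∈ Finset.range n, (deg b - ptr b) + freeCount n par + (tail - head)

namespace Search

variable {n m : ℕ} {deg nbr ok mA mB par ptr queue : ℕ → ℕ} {b₀ head tail found : ℕ}

theorem start (hb₀ : b₀ < n) (hpar : ∀ a < n, par a = n) (hptr : ∀ b < n, ptr b = 0)
    (hq : queue 0 = b₀) : Search n m deg nbr ok mA mB b₀ par ptr queue 0 1 n where
  tail_pos := one_pos
  root := hq
  queue_lt i hi := by obtain rfl : i = 0 := by omega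
                      omega
  head_le := by omega
  tree := ⟨0, fun a ha h => absurd (hpar a ha) h⟩
  tail_eq _ := by
    have : freeCount n par = n := by
      unfold freeCount
      rw [Finset.filter_true_of_mem fun a ha => hpar a (Finset.mem_range.mp ha)]
      simp
    omega
  visited _ a ha h := absurd (hpar a ha) h
  queue_par i hi := by obtain rfl : i = 0 := by omega
                       exact .inl hq
  ptr_le b hb := by simp [hptr b hb]
  scanned b hb j hj := by simp [hptr b hb] at hj
  done := by omega
  found_free h := absurd rfl h

theorem pop (h : Search n m deg nbr ok mA mB b₀ par ptr queue head tail found)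
    (ht : head < tail) (hd : deg (queue head) ≤ ptr (queue head)) :
    Search n m deg nbr ok mA mB b₀ par ptr queue (head + 1) tail found :=
  { h with
    head_le := ht
    done := fun i hi => by
      rcases Nat.lt_succ_iff_lt_or_eq.mp hi with hlt | rfl
      · exact h.done i hlt
      · exact hd }

theorem advance (h : Search n m deg nbr ok mA mB b₀ par ptr queue head tail found) {b : ℕ}
    (hj : ptr b < deg b)
    (hs : ok (nbr (b * m + ptr b) * n + b) = 0 ∨ par (nbr (b * m + ptr b)) ≠ n) :
    Search n m deg nbr ok mA mB b₀ par (Function.update ptr b (ptr b + 1)) queue head tail found :=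
  have hle : ∀ x, ptr x ≤ Function.update ptr b (ptr b + 1) x := fun x => by
    rcases eq_or_ne x b with rfl | hx
    · simp
    · simp [hx]
  { h with
    ptr_le := fun x hx => by
      rcases eq_or_ne x b with rfl | hxb
      · simpa using hj
      · simpa [hxb] using h.ptr_le x hx
    scanned := fun x hx j hjx hok => by
      rcases eq_or_ne x b with rfl | hxb
      · rw [Function.update_self] at hjx
        rcases Nat.lt_succ_iff_lt_or_eq.mp hjx with hlt | rfl
        · exact h.scanned x hx j hlt hok
        · exact hs.resolve_left hok
      · rw [Function.update_of_ne hxb] at hjx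
        exact h.scanned x hx j hjx hok
    done := fun i hi => (h.done i hi).trans (hle _) }

theorem advance_potential {b : ℕ} (hb : b < n) (hj : ptr b < deg b) :
    searchPotential n deg (Function.update ptr b (ptr b + 1)) par head tail <
      searchPotential n deg ptr par head tail := by
  have := sum_update_lt (f := ptr) (v := ptr b + 1) hb (fun b P => deg b - P) (by omega)
  unfold searchPotential
  omega

/-- Discovering the agent `a` from the object `b`. -/
theorem discover (h : Search n m deg nbr ok mA mB b₀ par ptr queue head tail n)
    (hm : MatchArrays n ok mA mB) {a b : ℕ} (ha : a < n) (ht : head < tail)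
    (hb : queue head = b) (hok : ok (a * n + b) ≠ 0) (hpa : par a = n) :
    if mA a < n then
      Search n m deg nbr ok mA mB b₀ (Function.update par a b) ptr
        (Function.update queue tail (mA a)) head (tail + 1) n
    else Search n m deg nbr ok mA mB b₀ (Function.update par a b) ptr queue head tail a := by
  have hbn : b < n := hb ▸ h.queue_lt head ht
  have hU := freeCount_update ha hpa hbn.ne
  have hmono : ∀ x, par x ≠ n → Function.update par a b x ≠ n := fun x hx => by
    rcases eq_or_ne x a with rfl | hxa
    · simpa using hbn.ne
    · simpa [hxa] using hx
  have htree : ∃ rk : ℕ → ℕ, ∀ x < n, Function.update par a b x ≠ n →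
      rk x + freeCount n (Function.update par a b) ≤ n ∧
        SearchTree n ok mB (Function.update par a b) rk b₀ x := by
    obtain ⟨rk, hrk⟩ := h.tree
    -- The new rank is the number of discovered agents including `a`. Older ranks are bounded by the
    -- previous count, which is one less.
    refine ⟨Function.update rk a (n - freeCount n (Function.update par a b)), fun x hx hxn => ?_⟩
    have hle := freeCount_le n (Function.update par a b)
    unfold SearchTree
    rcases eq_or_ne x a with rfl | hxa
    · simp only [Function.update_self]
      refine ⟨by omega, hbn, hok, fun hb0 => ?_⟩
      rcases h.queue_par head ht with h1 | ⟨h1, h2⟩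
      · exact absurd (hb.symm.trans h1) hb0
      · rw [hb] at h1 h2
        have hne : mB b ≠ x := by rintro rfl; exact h2 hpa
        refine ⟨h1, hmono _ h2, ?_⟩
        rw [Function.update_of_ne hne]
        have := (hrk _ h1 h2).1
        omega
    · rw [Function.update_of_ne hxa] at hxn ⊢
      obtain ⟨h1, h2, h3, h4⟩ := hrk x hx hxn
      rw [Function.update_of_ne hxa]
      refine ⟨by omega, h2, h3, fun hb0 => ?_⟩
      obtain ⟨h5, h6, h7⟩ := h4 hb0
      have hne : mB (par x) ≠ a := by intro he; rw [he] at h6; exact h6 hpa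
      refine ⟨h5, hmono _ h6, ?_⟩
      rw [Function.update_of_ne hne]
      exact h7
  split_ifs with hma
  · have hq : ∀ i < tail, Function.update queue tail (mA a) i = queue i := fun i hi => by
      simp [hi.ne]
    have hma' := hm.agent a ha hma.ne
    refine { h with tree := htree, found_free := fun h => absurd rfl h, tail_pos := ?_, root := ?_, queue_lt := ?_, head_le := ?_, tail_eq := ?_, visited := ?_, queue_par := ?_, scanned := ?_, done := ?_ }
    · omega
    · rw [hq 0 h.tail_pos]; exact h.root
    · intro i hi
      rcases Nat.lt_succ_iff_lt_or_eq.mp hi with hlt | rfl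
      · rw [hq i hlt]; exact h.queue_lt i hlt
      · simpa using hma
    · omega
    · intro _
      have := h.tail_eq rfl
      omega
    · intro _ x hx hxn
      rcases eq_or_ne x a with rfl | hxa
      · exact ⟨hma.ne, tail, by omega, by simp⟩
      · rw [Function.update_of_ne hxa] at hxn
        obtain ⟨h1, i, hi, h2⟩ := h.visited rfl x hx hxn
        exact ⟨h1, i, by omega, by rw [hq i hi, h2]⟩
    · intro i hi
      rcases Nat.lt_succ_iff_lt_or_eq.mp hi with hlt | rfl
      · rw [hq i hlt]
        exact (h.queue_par i hlt).imp_right fun h' => ⟨h'.1, hmono _ h'.2⟩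
      · refine .inr ?_
        simp only [Function.update_self, hma'.2.1]
        exact ⟨ha, hbn.ne⟩
    · exact fun x hx j hj hok => hmono _ (h.scanned x hx j hj hok)
    · intro i hi
      rw [hq i (by omega)]
      exact h.done i hi
  · have hma' : mA a = n := by
      by_contra hne
      exact hma (hm.agent a ha hne).1
    refine { h with tree := htree, tail_eq := ?_, visited := ?_, queue_par := ?_, scanned := ?_, found_free := ?_ }
    · omega
    · omega
    · exact fun i hi => (h.queue_par i hi).imp_right fun h' => ⟨h'.1, hmono _ h'.2⟩
    · exact fun x hx j hj hok => hmono _ (h.scanned x hx j hj hok)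
    · exact fun _ => ⟨ha, hma', by simpa using hbn.ne⟩

theorem tail_le (h : Search n m deg nbr ok mA mB b₀ par ptr queue head tail n) :
    tail ≤ n + 1 := by
  have := h.tail_eq rfl
  omega

/-- If the search fails, the queue is a set of objects all of whose neighbours are matched into
the set. -/
theorem closed (hA : AdjLists n m deg nbr ok)
    (h : Search n m deg nbr ok mA mB b₀ par ptr queue tail tail n) :
    ∃ R : Set ℕ, b₀ ∈ R ∧ ∀ b ∈ R, b < n ∧ ∀ a < n, ok (a * n + b) ≠ 0 →
      mA a ≠ n ∧ mA a ∈ R := by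
  refine ⟨{b | ∃ i < tail, queue i = b}, ⟨0, h.tail_pos, h.root⟩, ?_⟩
  rintro b ⟨i, hi, rfl⟩
  have hb := h.queue_lt i hi
  refine ⟨hb, fun a ha hok => ?_⟩
  obtain ⟨j, hj, rfl⟩ := hA.listed a ha _ hb hok
  exact h.visited rfl _ ha (h.scanned _ hb j (hj.trans_le (h.done i hi)) hok)

end Search

/-- The invariant while the matching is augmented along the search tree: `a` is a free agent from
which a path leads back to `b₀`, or `a = n` and the path has been exchanged. -/
def Augmenting (n : ℕ) (ok mA mB par rk : ℕ → ℕ) (b₀ F a : ℕ) : Prop :=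
  MatchArrays n ok mA mB ∧
    (a = n ∧ freeCount n mB + 1 = F ∨
      a < n ∧ mA a = n ∧ par a ≠ n ∧ b₀ < n ∧ mB b₀ = n ∧ freeCount n mB = F ∧
        ∀ x < n, par x ≠ n → rk x ≤ rk a → SearchTree n ok mB par rk b₀ x)

/-- The object `par a` passes from its old partner to `a`. The old partner becomes the free agent at
the end of a shorter path, so the number of free objects falls only when the root is reached. Only
agents of rank at most that of the current one need a valid tree entry, since the entries above may
be spoilt by the exchange. -/
theorem Augmenting.step {n : ℕ} {ok mA mB par rk : ℕ → ℕ} {b₀ F a : ℕ}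
    (h : Augmenting n ok mA mB par rk b₀ F a) (ha : a < n) :
    par a < n ∧ Augmenting n ok (Function.update (Function.update mA (mB (par a)) n) a (par a))
        (Function.update mB (par a) a) par rk b₀ F (mB (par a)) ∧
      (mB (par a) < n → rk (mB (par a)) < rk a) ∧ mB (par a) ≤ n := by
  obtain ⟨hm, ⟨h1, _⟩ | ⟨_, hfree, hpar, hb₀, hmb₀, hF, htree⟩⟩ := h
  · omega
  obtain ⟨hp, hok, hnext⟩ := htree a ha hpar le_rfl
  have hm' := hm.shift ha hp hok hfree
  by_cases hroot : par a = b₀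
  · have hn : mB (par a) = n := by rw [hroot, hmb₀]
    refine ⟨hp, ⟨hm', .inl ⟨hn, ?_⟩⟩, by omega, hn.le⟩
    rw [freeCount_update hp hn ha.ne, hF]
  · obtain ⟨h1, h2, h3⟩ := hnext hroot
    refine ⟨hp, ⟨hm', .inr ⟨h1, ?_, h2, hb₀, ?_, ?_, ?_⟩⟩, fun _ => h3, h1.le⟩
    · have : mB (par a) ≠ a := by intro he; rw [he] at h3; omega
      simp [this]
    · rw [Function.update_of_ne (Ne.symm hroot), hmb₀]
    · rw [← hF]
      refine freeCount_congr fun b hb => ?_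
      rcases eq_or_ne b (par a) with rfl | hne
      · simp; omega
      · simp [hne]
    · intro x hx hxn hxr
      obtain ⟨g1, g2, g3⟩ := htree x hx hxn (by omega)
      refine ⟨g1, g2, fun hxb => ?_⟩
      obtain ⟨k1, k2, k3⟩ := g3 hxb
      -- Otherwise the old partner of `par a` would have a smaller rank than `x`, whose rank is at
      -- most its own.
      have : par x ≠ par a := by intro he; rw [he] at k3; omega
      rw [Function.update_of_ne this]
      exact ⟨k1, k2, k3⟩

theorem Search.augmenting {n m : ℕ} {deg nbr ok mA mB par ptr queue : ℕ → ℕ}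
    {b₀ head tail found : ℕ}
    (h : Search n m deg nbr ok mA mB b₀ par ptr queue head tail found) (hf : found ≠ n)
    (hm : MatchArrays n ok mA mB) (hb₀ : b₀ < n) (hmb₀ : mB b₀ = n) :
    ∃ rk, rk found ≤ n ∧ Augmenting n ok mA mB par rk b₀ (freeCount n mB) found := by
  obtain ⟨rk, hrk⟩ := h.tree
  obtain ⟨h1, h2, h3⟩ := h.found_free hf
  exact ⟨rk, by have := (hrk _ h1 h3).1; omega, hm, .inr ⟨h1, h2, h3, hb₀, hmb₀, rfl,
    fun x hx hxn _ => (hrk x hx hxn).2⟩⟩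

/-! ### Popularity, tight edges and levels. -/

open Classical in
/-- `1` if agent `a` prefers `b` to `b'`, and `0` otherwise. -/
noncomputable def pref01 {A B : Type*} (G : Market A B) (a : A) (b b' : B) : ℕ :=
  if G.pref a b b' then 1 else 0

/-- The edge `ab` is tight for the levels `l`: no neighbour `b'` of `a` beats `b`, where a better
level counts as much as a better rank. -/
def Tight {A B : Type*} (G : Market A B) (l : B → ℕ) (a : A) (b : B) : Prop :=
  (a, b) ∈ G.E ∧ ∀ b', (a, b') ∈ G.E → l b' + pref01 G a b' b ≤ l b + pref01 G a b b'

/-- The assignment given by a bijection. -/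
def graphFinset {n : ℕ} (σ : Fin n ≃ Fin n) : Finset (Fin n × Fin n) :=
  Finset.univ.map ⟨fun a => (a, σ a), fun _ _ h => congrArg Prod.fst h⟩

theorem mem_graphFinset {n : ℕ} {σ : Fin n ≃ Fin n} {a b : Fin n} :
    (a, b) ∈ graphFinset σ ↔ σ a = b := by
  constructor
  · intro h
    obtain ⟨c, _, hc⟩ := Finset.mem_map.mp h
    cases hc
    rfl
  · rintro rfl
    exact Finset.mem_map.mpr ⟨a, Finset.mem_univ a, rfl⟩

section

variable {n : ℕ} {G : Market (Fin n) (Fin n)}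

theorem isAssignment_graphFinset {σ : Fin n ≃ Fin n} (h : ∀ a, (a, σ a) ∈ G.E) :
    IsAssignment G (graphFinset σ) := by
  refine ⟨⟨?_, ?_⟩, fun a => ⟨σ a, mem_graphFinset.mpr rfl⟩,
    fun b => ⟨σ.symm b, mem_graphFinset.mpr (by simp)⟩⟩
  · rintro ⟨a, b⟩ hab
    rw [mem_graphFinset] at hab
    exact hab ▸ h a
  · rintro ⟨a, b⟩ hab ⟨a', b'⟩ hab' hor
    rw [mem_graphFinset] at hab hab'
    subst hab hab'
    rcases hor with h | h
    · simp only at h; rw [h]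
    · simp only [EmbeddingLike.apply_eq_iff_eq] at h; rw [h]

theorem IsAssignment.exists_equiv {M : Finset (Fin n × Fin n)} (h : IsAssignment G M) :
    ∃ σ : Fin n ≃ Fin n, M = graphFinset σ ∧ ∀ a, (a, σ a) ∈ G.E := by
  obtain ⟨⟨hE, huniq⟩, hA, hB⟩ := h
  choose f hf using hA
  have hinj : Function.Injective f := fun a a' he =>
    congrArg Prod.fst (huniq _ (hf a) _ (hf a') (.inr he))
  refine ⟨Equiv.ofBijective f ((Finite.injective_iff_bijective).mp hinj), ?_, fun a => hE (hf a)⟩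
  ext ⟨a, b⟩
  rw [mem_graphFinset, Equiv.ofBijective_apply]
  exact ⟨fun hab => congrArg Prod.snd (huniq _ (hf a) _ hab (.inl rfl)), fun he => he ▸ hf a⟩

theorem prefers_graphFinset {σ τ : Fin n ≃ Fin n} {a : Fin n} :
    Prefers G a (graphFinset σ) (graphFinset τ) ↔ G.pref a (σ a) (τ a) := by
  simp [Prefers, mem_graphFinset]

theorem votes_graphFinset (σ τ : Fin n ≃ Fin n) :
    votes G (graphFinset σ) (graphFinset τ) = ∑ a, pref01 G a (σ a) (τ a) := by
  classical
  simp only [votes, prefers_graphFinset, pref01]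
  rw [Finset.sum_boole, Set.ncard_eq_toFinset_card']
  simp

theorem margin_graphFinset (σ τ : Fin n ≃ Fin n) :
    margin G (graphFinset σ) (graphFinset τ) =
      ∑ a, ((pref01 G a (σ a) (τ a) : ℤ) - pref01 G a (τ a) (σ a)) := by
  rw [margin, votes_graphFinset, votes_graphFinset, Finset.sum_sub_distrib]
  push_cast
  rfl

/-- An assignment of tight edges is popular. -/
theorem isPopularAssignment_of_tight {l : Fin n → ℕ} {σ : Fin n ≃ Fin n}
    (h : ∀ a, Tight G l a (σ a)) : IsPopularAssignment G (graphFinset σ) := by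
  refine ⟨isAssignment_graphFinset fun a => (h a).1, fun N hN => ?_⟩
  obtain ⟨τ, rfl, hτ⟩ := hN.exists_equiv
  rw [margin_graphFinset]
  -- Both bijections run through all objects once, so the levels cancel.
  have h1 : ∑ a, ((l (τ a) : ℤ) - l (σ a)) = 0 := by
    rw [Finset.sum_sub_distrib, Equiv.sum_comp τ fun b => (l b : ℤ),
      Equiv.sum_comp σ fun b => (l b : ℤ), sub_self]
  rw [← h1]
  refine Finset.sum_le_sum fun a _ => ?_
  have := (h a).2 (τ a) (hτ a)
  omega

/-- Levels between `1` and `n` with an assignment of tight edges. -/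
def IsTarget (G : Market (Fin n) (Fin n)) (L : Fin n → ℕ) : Prop :=
  (∀ b, 1 ≤ L b ∧ L b ≤ n) ∧ ∃ σ : Fin n ≃ Fin n, ∀ a, Tight G L a (σ a)

/-- The weight of the walk through the vertices of a list. -/
def walkWeight {V : Type*} (c : V → V → ℤ) : List V → ℤ
  | [] => 0
  | [_] => 0
  | x :: y :: l => c x y + walkWeight c (y :: l)

theorem walkWeight_append_singleton {V : Type*} (c : V → V → ℤ) (q : List V) (x : V) (r : List V) :
    walkWeight c (q ++ x :: r) = walkWeight c (q ++ [x]) + walkWeight c (x :: r) := by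
  induction q with
  | nil => simp [walkWeight]
  | cons y q ih =>
    cases q with
    | nil => simp [walkWeight]
    | cons z q =>
      simp only [List.cons_append, walkWeight] at ih ⊢
      rw [ih, add_assoc]

theorem walkWeight_eq_sum {V : Type*} (c : V → V → ℤ) (l : List V) :
    walkWeight c l = ∑ i : Fin (l.length - 1),
      c (l[(i : ℕ)]'(by omega)) (l[(i : ℕ) + 1]'(by omega)) := by
  induction l with
  | nil => simp [walkWeight]
  | cons x l ih =>
    cases l with
    | nil => simp [walkWeight]
    | cons y l =>
      rw [walkWeight, ih]
      exact (Fin.sum_univ_succ (n := l.length) fun i =>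
        c ((x :: y :: l)[(i : ℕ)]'(by simp))
          ((x :: y :: l)[(i : ℕ) + 1]'(by simp; omega))).symm

/-- The cyclic permutation of a list realises the weight of the closed walk. -/
theorem sum_formPerm {V : Type*} [Fintype V] [DecidableEq V] (c : V → V → ℤ)
    (hc : ∀ x, c x x = 0) (x : V) (q : List V) (h : (x :: q).Nodup) :
    ∑ v, c v ((x :: q).formPerm v) = walkWeight c (x :: q ++ [x]) := by
  -- Vertices off the list are fixed by the permutation and contribute `c x x = 0`.
  have h1 : ∑ v, c v ((x :: q).formPerm v) =
      ∑ v ∈ (x :: q).toFinset, c v ((x :: q).formPerm v) := by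
    refine (Finset.sum_subset (Finset.subset_univ _) fun v _ hv => ?_).symm
    rw [List.formPerm_apply_of_notMem (by simpa using hv), hc]
  have h2 : ∑ v ∈ (x :: q).toFinset, c v ((x :: q).formPerm v) =
      ∑ i : Fin (x :: q).length, c ((x :: q)[(i : ℕ)]) ((x :: q).formPerm (x :: q)[(i : ℕ)]) := by
    rw [List.sum_toFinset _ h, ← Fin.sum_univ_fun_getElem]
  rw [h1, h2, walkWeight_eq_sum]
  have hlen : (x :: q ++ [x]).length - 1 = (x :: q).length := by simp
  refine Fintype.sum_equiv (finCongr hlen.symm) _ _ fun i => ?_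
  have hi := i.isLt
  simp only [finCongr_apply, Fin.val_cast]
  rw [List.formPerm_apply_getElem _ h]
  congr 1
  · rw [List.getElem_append_left]
  · by_cases hlast : (i : ℕ) + 1 < (x :: q).length
    · rw [List.getElem_append_left hlast]
      simp only [Nat.mod_eq_of_lt hlast]
    · have he : (i : ℕ) + 1 = (x :: q).length := by omega
      simp [he]

/-- Potentials for a digraph without positive cycles, where `c` is at most `1`. -/
theorem exists_potential {V : Type*} [Fintype V] [DecidableEq V] (R : V → V → Prop)
    (c : V → V → ℤ) (hR : ∀ x, R x x) (hc : ∀ x, c x x = 0) (hc1 : ∀ x y, c x y ≤ 1)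
    (hcyc : ∀ π : Equiv.Perm V, (∀ x, R x (π x)) → ∑ x, c x (π x) ≤ 0) :
    ∃ f : V → ℕ, (∀ x, f x < Fintype.card V) ∧
      ∀ x y, R x y → (f y : ℤ) + c x y ≤ f x := by
  classical
  -- The weights of the simple paths that start at `x`; the potential is their maximum. Each arc
  -- weighs at most $1$, so a simple path weighs less than the number of vertices.
  let W : V → Set ℤ := fun x => {k | ∃ l : List V, (x :: l).Nodup ∧ List.IsChain R (x :: l) ∧
    walkWeight c (x :: l) = k}
  have hbound : ∀ x l, walkWeight c (x :: l) ≤ (l.length : ℤ) := by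
    intro x l
    induction l generalizing x with
    | nil => simp [walkWeight]
    | cons y l ih =>
      have := ih y
      have := hc1 x y
      simp only [walkWeight, List.length_cons, Nat.cast_add, Nat.cast_one]
      omega
  have hlt : ∀ x, ∀ k ∈ W x, k < Fintype.card V := by
    rintro x k ⟨l, hl, _, rfl⟩
    have := hl.length_le_card
    have := hbound x l
    simp only [List.length_cons] at *
    omega
  have h0 : ∀ x, (0 : ℤ) ∈ W x := fun x => ⟨[], by simp, by simp, rfl⟩
  have hmax : ∀ x, ∃ k ∈ W x, ∀ k' ∈ W x, k' ≤ k := fun x => by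
    obtain ⟨k, hk, hk'⟩ := Int.exists_greatest_of_bdd
      (P := fun k => k ∈ W x) ⟨Fintype.card V, fun k hk => (hlt x k hk).le⟩ ⟨0, h0 x⟩
    exact ⟨k, hk, hk'⟩
  choose f hf hfmax using hmax
  have hf0 : ∀ x, 0 ≤ f x := fun x => hfmax x 0 (h0 x)
  refine ⟨fun x => (f x).toNat, fun x => ?_, fun x y hxy => ?_⟩
  · have := hlt x _ (hf x)
    have := hf0 x
    show (f x).toNat < _
    omega
  · have hx0 := hf0 x
    have hy0 := hf0 y
    suffices f y + c x y ≤ f x by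
      show ((f y).toNat : ℤ) + c x y ≤ (f x).toNat
      omega
    obtain ⟨l, hnd, hch, hw⟩ := hf y
    -- If the best path from `y` avoids `x`, it can be prolonged by the arc from `x`. Otherwise it
    -- is cut at `x`: its beginning closes to a cycle through the arc from `x` to `y`, of weight at
    -- most $0$, and its end is a simple path from `x`.
    by_cases hmem : x ∈ y :: l
    · obtain ⟨q, r, hqr⟩ := List.append_of_mem hmem
      have hnd' := hnd
      rw [hqr] at hnd' hch hw
      have hr : walkWeight c (x :: r) ≤ f x :=
        hfmax x _ ⟨r, (List.nodup_append.mp hnd').2.1, hch.right_of_append, rfl⟩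
      rw [walkWeight_append_singleton] at hw
      have hq : (x :: q).Nodup := by
        have := List.nodup_append.mp hnd'
        rw [List.nodup_cons]
        exact ⟨fun h => this.2.2 x h x (by simp) rfl, this.1⟩
      have hcl : List.IsChain R (x :: q ++ [x]) := by
        have h1 : List.IsChain R (q ++ [x]) := by
          have : q ++ x :: r = (q ++ [x]) ++ r := by simp
          rw [this] at hch
          exact hch.left_of_append
        rw [List.cons_append, List.isChain_cons]
        refine ⟨fun z hz => ?_, h1⟩
        have : (q ++ [x]).head? = some y := by
          cases q with
          | nil => simp at hqr; simp [hqr.1]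
          | cons z q => simp at hqr; simp [hqr.1]
        rw [this] at hz
        simp at hz
        exact hz ▸ hxy
      have hcw : walkWeight c (x :: q ++ [x]) = c x y + walkWeight c (q ++ [x]) := by
        cases q with
        | nil => simp at hqr; simp [walkWeight, hqr.1]
        | cons z q => simp at hqr; simp [walkWeight, hqr.1]
      have hle := hcyc (x :: q).formPerm fun v => by
        by_cases hv : v ∈ x :: q
        · obtain ⟨i, hi, rfl⟩ := List.mem_iff_getElem.mp hv
          rw [List.formPerm_apply_getElem _ hq]
          have := (List.isChain_iff_getElem.mp hcl) i (by simp at hi ⊢; omega)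
          rw [List.getElem_append_left hi] at this
          convert this using 1
          by_cases hlast : i + 1 < (x :: q).length
          · rw [List.getElem_append_left hlast]
            simp only [Nat.mod_eq_of_lt hlast]
          · have he : i + 1 = (x :: q).length := by omega
            simp [he]
        · rw [List.formPerm_apply_of_notMem hv]
          exact hR v
      rw [sum_formPerm c hc x q hq, hcw] at hle
      omega
    · have : c x y + f y ∈ W x := ⟨y :: l, List.nodup_cons.mpr ⟨hmem, hnd⟩, by
        rw [List.isChain_cons_cons]; exact ⟨hxy, hch⟩, by rw [walkWeight, hw]⟩
      have := hfmax x _ this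
      omega

/-- A permutation of the agents along arcs turns `σ` into another assignment, and its total weight
is the margin of that assignment over `σ`. Popularity thus excludes positive total weight, and the
potential supplies the levels. -/
theorem IsPopularAssignment.exists_isTarget {M : Finset (Fin n × Fin n)}
    (h : IsPopularAssignment G M) : ∃ L, IsTarget G L := by
  obtain ⟨σ, rfl, hσ⟩ := h.1.exists_equiv
  obtain ⟨f, hf, hf'⟩ := exists_potential (fun x y : Fin n => (x, σ y) ∈ G.E)
    (fun x y => (pref01 G x (σ y) (σ x) : ℤ) - pref01 G x (σ x) (σ y)) hσ (by simp)
    (fun x y => by unfold pref01; split_ifs <;> simp)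
    (fun π hπ => by
      have := h.2 _ (isAssignment_graphFinset (σ := π.trans σ) hπ)
      rw [margin_graphFinset] at this
      rw [← neg_nonneg, ← Finset.sum_neg_distrib]
      simpa using this)
  -- The shift by one keeps targets above level $0$, where the table of tight edges may be
  -- incomplete.
  refine ⟨fun b => f (σ.symm b) + 1, fun b => ⟨Nat.le_add_left _ _, ?_⟩, σ, fun a => ⟨hσ a, fun b hb => ?_⟩⟩
  · have := hf (σ.symm b)
    rw [Fintype.card_fin] at this
    exact this
  · have := hf' a (σ.symm b) (by simpa using hb)
    simp only [Equiv.apply_symm_apply, Equiv.symm_apply_apply] at this ⊢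
    omega

/-- A free object in a set that is closed under alternating paths has too small a level. -/
theorem IsTarget.lt_of_closed {L : Fin n → ℕ} (hL : IsTarget G L) {lev : Fin n → ℕ}
    (hle : ∀ b, lev b ≤ L b) {ok : Fin n → Fin n → Prop}
    (hsound : ∀ a b, ok a b → Tight G lev a b)
    (hcomplete : ∀ a b, 1 ≤ lev b → Tight G lev a b → ok a b)
    {R : Set (Fin n)} {mate : Fin n → Option (Fin n)}
    (hmate : ∀ a a' b, mate a = some b → mate a' = some b → a = a')
    (hmok : ∀ a b, mate a = some b → ok a b)
    (hclosed : ∀ b ∈ R, ∀ a, ok a b → ∃ b' ∈ R, mate a = some b')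
    {b₀ : Fin n} (hb₀ : b₀ ∈ R) (hfree : ∀ a, mate a ≠ some b₀) : lev b₀ < L b₀ := by
  classical
  obtain ⟨hL1, σ, hσ⟩ := hL
  by_contra hlt
  -- The objects of `R` whose level is exactly the target. If `b₀` were among them, following a
  -- target edge to an agent and then its current partner would give an injection of this finite set
  -- into itself that misses `b₀`.
  let S := {b : Fin n // b ∈ R ∧ lev b = L b}
  have step : ∀ b : S, ∃ b' : S, mate (σ.symm b) = some b'.1 := by
    rintro ⟨b, hbR, hb⟩
    have hσb := hσ (σ.symm b)
    rw [Equiv.apply_symm_apply] at hσb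
    -- Equality holds at `b` and the other levels are no larger than in the target, so target
    -- tightness is inherited.
    have htight : Tight G lev (σ.symm b) b := by
      refine ⟨hσb.1, fun b' hb' => ?_⟩
      have := hσb.2 b' hb'
      have := hle b'
      omega
    obtain ⟨b', hb'R, hb'⟩ := hclosed b hbR _
      (hcomplete _ b (by rw [hb]; exact (hL1 b).1) htight)
    have ht' := hsound _ _ (hmok _ _ hb')
    -- Tightness of the matched edge for `lev` and of the target edge for `L` give opposite
    -- inequalities, which force the levels to agree at `b'` too.
    have h1 := ht'.2 b hσb.1
    have h2 := hσb.2 b' ht'.1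
    have h3 := hle b'
    exact ⟨⟨b', hb'R, by omega⟩, hb'⟩
  choose g hg using step
  have hinj : Function.Injective g := fun b c hbc => by
    have h1 := hg b
    rw [hbc] at h1
    exact Subtype.ext (σ.symm.injective (hmate _ _ _ h1 (hg c)))
  obtain ⟨b, hb⟩ := (Finite.injective_iff_surjective.mp hinj)
    ⟨b₀, hb₀, le_antisymm (hle b₀) (not_lt.mp hlt)⟩
  have := hg b
  rw [hb] at this
  exact hfree _ this

theorem IsAssignment.card_le {M : Finset (Fin n × Fin n)} (h : IsAssignment G M) :
    n ≤ G.E.card := by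
  obtain ⟨σ, _, hσ⟩ := h.exists_equiv
  simpa using Finset.card_le_card_of_injOn (s := Finset.univ) (fun a => (a, σ a))
    (fun a _ => hσ a) fun a _ b _ h => congrArg Prod.fst h

end

end PopAssign

namespace WordRAM

/-! ### Expressions and arithmetic without overflow. -/

instance : Add Exp := ⟨.bin .add⟩
instance : Mul Exp := ⟨.bin .mul⟩

/-- The comparison `e < f` as an expression. -/
def Exp.less (e f : Exp) : Exp := .bin .lt e f

/-- The comparison `e = f` as an expression. -/
def Exp.equal (e f : Exp) : Exp := .bin .eq e f

/-- A register as an expression. -/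
abbrev X (r : ℕ) : Exp := .reg r

section

variable (w : ℕ) (s : State) (e f : Exp)

@[simp] theorem Exp.eval_const (c : ℕ) : (Exp.const c).eval w s = c % 2 ^ w := rfl
@[simp] theorem Exp.eval_add : (e + f).eval w s = (e.eval w s + f.eval w s) % 2 ^ w := rfl
@[simp] theorem Exp.eval_mul : (e * f).eval w s = (e.eval w s * f.eval w s) % 2 ^ w := rfl
@[simp] theorem Exp.eval_less :
    (e.less f).eval w s = if e.eval w s < f.eval w s then 1 else 0 := rfl
@[simp] theorem Exp.eval_equal :
    (e.equal f).eval w s = if e.eval w s = f.eval w s then 1 else 0 := rfl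
@[simp] theorem Exp.eval_reg (r : ℕ) : (Exp.reg r).eval w s = s.reg r := rfl
@[simp] theorem Exp.eval_get (a : ℕ) : (Exp.get a e).eval w s = s.arr a (e.eval w s) := rfl

@[simp] theorem Exp.cost_add : (e + f).cost = e.cost + f.cost + 1 := rfl
@[simp] theorem Exp.cost_mul : (e * f).cost = e.cost + f.cost + 1 := rfl
@[simp] theorem Exp.cost_less : (e.less f).cost = e.cost + f.cost + 1 := rfl
@[simp] theorem Exp.cost_equal : (e.equal f).cost = e.cost + f.cost + 1 := rfl

end

section

variable {w n : ℕ}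

theorem mod_word (hw : (n + 2) ^ 4 ≤ 2 ^ w) {x : ℕ} (hx : x ≤ n * n + n + 2) :
    x % 2 ^ w = x :=
  Nat.mod_eq_of_lt (lt_of_lt_of_le (by nlinarith [Nat.zero_le (n ^ 4), Nat.zero_le (n ^ 3)]) hw)

theorem mod_word_index (hw : (n + 2) ^ 4 ≤ 2 ^ w) {a k j : ℕ} (ha : a ≤ n) (hk : k ≤ n * n)
    (hj : j ≤ n * n) : (a * k % 2 ^ w + j) % 2 ^ w = a * k + j := by
  have h : a * k ≤ n * (n * n) := Nat.mul_le_mul ha hk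
  have h4 : n * (n * n) + n * n < (n + 2) ^ 4 := by
    nlinarith [Nat.zero_le (n ^ 4), Nat.zero_le (n ^ 3), Nat.zero_le (n ^ 2)]
  rw [Nat.mod_eq_of_lt (a := a * k) (by omega), Nat.mod_eq_of_lt (by omega)]

/-- Cells of the preference table have addresses of order $n^3$, the largest numbers that occur;
this is why the word length exponent is $4$. -/
theorem mod_word_index₃ (hw : (n + 2) ^ 4 ≤ 2 ^ w) {a b c : ℕ} (ha : a < n) (hb : b < n)
    (hc : c < n) :
    ((a * n % 2 ^ w + b) % 2 ^ w * n % 2 ^ w + c) % 2 ^ w = (a * n + b) * n + c := by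
  have hn : n ≤ n * n := Nat.le_mul_self n
  rw [mod_word_index hw ha.le hn (by omega)]
  have h1 : (a + 1) * n ≤ n * n := Nat.mul_le_mul_right n ha
  rw [Nat.succ_mul] at h1
  have h2 : (a * n + b) * n ≤ n * n * n := Nat.mul_le_mul_right n (by omega)
  have h4 : n * n * n + n < (n + 2) ^ 4 := by
    nlinarith [Nat.zero_le (n ^ 4), Nat.zero_le (n ^ 3), Nat.zero_le (n ^ 2)]
  rw [Nat.mod_eq_of_lt (a := (a * n + b) * n) (by omega), Nat.mod_eq_of_lt (by omega)]

end

end WordRAM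

namespace PopAssign

open WordRAM

/-! Registers: `0` the number `n` of agents, `1` the number `m` of edges, `2` the cap of the
auction, `3` whether the main loop goes on, `4` a counter, `5` the number of objects that have
entered the auction, `6` the bidding object, `7` and `8` an agent and an object, `9` the outcome of
the augmentation phase, `10` a free object, `11`, `12` head and tail of the queue, `13` the end of
an augmenting path, `14` the answer.

Arrays: `0`, `1`, `2` the input, `3`, `4` the partners of agents and objects, `5` prices, `6` bids,
`7` list pointers, `8` degrees of objects, `9` lists of neighbours of objects, `10` the table of
tight edges, `11` the table of edges, `12` levels, `13` the search tree, `14` the queue. -/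

infixr:50 " ;; " => Prog.seq

/-! ### The auction as a program. -/

/-- Set up the arrays for the auction. -/
def auctionReset : Prog :=
  .set 4 (.const 0) ;; .loop ((X 4).less (X 0))
    (.store 3 (X 4) (X 0) ;; .store 4 (X 4) (X 0) ;; .store 5 (X 4) (.const 0) ;; .store 6 (X 4) (.const 0) ;;
      .store 7 (X 4) (.const 0) ;; .set 4 (X 4 + .const 1)) ;; .set 5 (.const 0) ;; .set 6 (X 0)

/-- One step of the auction. -/
def auctionStep : Prog :=
  .cond ((X 6).less (X 0))
    (.cond ((Exp.get 7 (X 6)).less (.get 8 (X 6)))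
      (.set 7 (.get 9 (X 6 * X 1 + .get 7 (X 6))) ;;
        .cond ((Exp.get 10 (X 7 * X 0 + X 6)).equal (.const 0))
          (.store 7 (X 6) (.get 7 (X 6) + .const 1))
          (.cond ((Exp.get 6 (X 6)).less (.get 5 (X 7)))
            (.store 7 (X 6) (.get 7 (X 6) + .const 1))
            -- If the agent was free, register `8` holds `n` and the next write hits cell `n`, which
            -- no invariant reads.
            (.set 8 (.get 3 (X 7)) ;; .store 4 (X 8) (X 0) ;; .store 4 (X 6) (X 7) ;;
              .store 3 (X 7) (X 6) ;; .store 5 (X 7) (.get 6 (X 6) + .const 1) ;; .set 6 (X 8))))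
      (.store 6 (X 6) (.get 6 (X 6) + .const 1) ;; .store 7 (X 6) (.const 0) ;;
        .cond ((Exp.get 6 (X 6)).less (X 2)) .skip (.set 6 (X 0))))
    (.set 6 (X 5) ;; .set 5 (X 5 + .const 1))

/-- Find a matching that is nearly maximum among the tight edges. -/
def auction : Prog :=
  -- Both registers are at most $n$, so the sum is below $2n$ until every object has entered and
  -- nobody is bidding.
  auctionReset ;; .loop ((X 5 + X 6).less (X 0 + X 0)) auctionStep

/-- The facts about sizes on which the arithmetic of the program relies. -/
structure Sizes (w n m K : ℕ) (s : State) : Prop where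
  word : (n + 2) ^ 4 ≤ 2 ^ w
  m_le : m ≤ n * n
  K_le : K ≤ n
  le_sq : n ≤ K * K
  reg0 : s.reg 0 = n
  reg1 : s.reg 1 = m
  reg2 : s.reg 2 = K

theorem Sizes.of_frame {w n m K : ℕ} {s s' : State} {p : Prog} (h : Sizes w n m K s)
    (hf : Frame p s s') (h0 : 0 ∉ p.regs := by decide) (h1 : 1 ∉ p.regs := by decide)
    (h2 : 2 ∉ p.regs := by decide) : Sizes w n m K s' :=
  { h with
    reg0 := (hf.reg 0 h0).trans h.reg0
    reg1 := (hf.reg 1 h1).trans h.reg1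
    reg2 := (hf.reg 2 h2).trans h.reg2 }

theorem AdjLists.deg_le {n m : ℕ} {deg nbr ok : ℕ → ℕ} (h : AdjLists n m deg nbr ok) {b : ℕ}
    (hb : b < n) : deg b ≤ m := by
  rw [← h.deg_sum]
  exact Finset.single_le_sum (f := deg) (fun _ _ => Nat.zero_le _) (Finset.mem_range.mpr hb)

section

variable {w n m K : ℕ} {s : State}

theorem does_auctionReset (hS : Sizes w n m K s) :
    Does w auctionReset s (n * 26 + 10) fun s' =>
      (∀ i < n, s'.arr 3 i = n ∧ s'.arr 4 i = n ∧ s'.arr 5 i = 0 ∧ s'.arr 6 i = 0 ∧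
        s'.arr 7 i = 0) ∧ s'.reg 5 = 0 ∧ s'.reg 6 = n := by
  have hw := hS.word
  have e0 : 0 % 2 ^ w = 0 := Nat.zero_mod _
  have e1 : 1 % 2 ^ w = 1 := mod_word hw (by omega)
  refine (Does.straight_seq (by rfl) fun s₁ f₁ h₁ => (Does.loop_straight (by rfl) n
      (fun s' => s'.reg 4 ≤ n ∧ ∀ i < s'.reg 4, s'.arr 3 i = n ∧ s'.arr 4 i = n ∧
        s'.arr 5 i = 0 ∧ s'.arr 6 i = 0 ∧ s'.arr 7 i = 0) (fun s' => n - s'.reg 4)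
      (by simp [h₁, Prog.exec]) (by omega) fun s f ⟨h, h'⟩ hg => ?_).seq
      (fun s₂ f₂ h₂ => Does.straight (by rfl) ?_)).mono ?_ (fun _ _ h => h)
  · have hS' := (hS.of_frame f₁).of_frame f
    simp [hS'.reg0] at hg
    have ei : (s.reg 4 + 1) % 2 ^ w = s.reg 4 + 1 := mod_word hw (by nlinarith)
    simp [Prog.exec, hS'.reg0, e1, ei]
    refine ⟨⟨hg, fun i hi => ?_⟩, by omega⟩
    rcases eq_or_ne i (s.reg 4) with rfl | hne
    · simp
    · simpa [hne] using h' i (by omega)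
  · have hS₂ := (hS.of_frame f₁).of_frame f₂
    obtain ⟨⟨h, h'⟩, hg⟩ := h₂
    simp [hS₂.reg0] at hg
    simp [Prog.exec, hS₂.reg0]
    exact fun i hi => h' i (by omega)
  · simp [Prog.maxCost, Exp.cost]
    omega

/-- Each branch of the program is one of the transitions `skip`, `take`, `bid` and `next` of
`Auction`; what remains is to see that no address, bid or pointer overflows. -/
theorem auctionStep_correct (hS : Sizes w n m K s)
    (hA : AdjLists n m (s.arr 8) (s.arr 9) (s.arr 10))
    (h : Auction n m K (s.arr 8) (s.arr 9) (s.arr 10) (s.arr 3) (s.arr 4) (s.arr 5) (s.arr 6)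
      (s.arr 7) (s.reg 5) (s.reg 6)) (hg : s.reg 5 + s.reg 6 < n + n)
    {s' : State} (hs' : s' = auctionStep.exec w s) :
    Auction n m K (s.arr 8) (s.arr 9) (s.arr 10) (s'.arr 3) (s'.arr 4) (s'.arr 5) (s'.arr 6)
      (s'.arr 7) (s'.reg 5) (s'.reg 6) ∧
    auctionPotential n K (s.arr 8) (s'.arr 5) (s'.arr 6) (s'.arr 7) (s'.reg 5) <
      auctionPotential n K (s.arr 8) (s.arr 5) (s.arr 6) (s.arr 7) (s.reg 5) := by
  have hw := hS.word
  have hn : n ≤ n * n := Nat.le_mul_self n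
  have hK := hS.K_le
  have hm := hS.m_le
  have e0 : 0 % 2 ^ w = 0 := Nat.zero_mod _
  have e1 : 1 % 2 ^ w = 1 := mod_word hw (by omega)
  have hq := h.q_le
  by_cases hc : s.reg 6 < n
  · have hd := (h.cur_lt hc).2.2
    have hdeg := hA.deg_le hc
    have hptr := h.ptr_le _ hc
    have ed : (s.arr 6 (s.reg 6) + 1) % 2 ^ w = s.arr 6 (s.reg 6) + 1 := mod_word hw (by omega)
    by_cases hj : s.arr 7 (s.reg 6) < s.arr 8 (s.reg 6)
    · have ei : (s.reg 6 * m % 2 ^ w + s.arr 7 (s.reg 6)) % 2 ^ w =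
          s.reg 6 * m + s.arr 7 (s.reg 6) := mod_word_index hw hc.le hm (by omega)
      have ha := hA.nbr_lt _ hc _ hj
      have ej := mod_word_index hw ha.le hn (hc.le.trans hn)
      have ep : (s.arr 7 (s.reg 6) + 1) % 2 ^ w = s.arr 7 (s.reg 6) + 1 :=
        mod_word hw (by omega)
      by_cases hok : s.arr 10 (s.arr 9 (s.reg 6 * m + s.arr 7 (s.reg 6)) * n + s.reg 6) = 0
      · have := h.skip hc hj (.inl hok)
        have := h.skip_potential hc hj
        simp_all [auctionStep, Prog.exec, hS.reg0, hS.reg1]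
      · by_cases hp : s.arr 6 (s.reg 6) < s.arr 5 (s.arr 9 (s.reg 6 * m + s.arr 7 (s.reg 6)))
        · have := h.skip hc hj (.inr hp)
          have := h.skip_potential hc hj
          simp_all [auctionStep, Prog.exec, hS.reg0, hS.reg1]
        · have := h.take hc ha hok (not_lt.mp hp)
          have := h.take_potential hc ha (not_lt.mp hp)
          subst hs'
          simp [auctionStep, Prog.exec, hS.reg0, hS.reg1, hc, hj, ei, ej, hok, hp, e0, ed]
          constructor <;> assumption
    · have h1 := h.bid hA hc (not_lt.mp hj)
      have h2 := h.bid_potential hc (not_lt.mp hj)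
      subst hs'
      simp [auctionStep, Prog.exec, hS.reg0, hS.reg2, hc, hj, ed, e0]
      by_cases hlt : s.arr 6 (s.reg 6) + 1 < K
      · simp [hlt, hlt.not_ge, h2] at h1 ⊢; exact h1
      · simp [hlt, not_lt.mp hlt, h2] at h1 ⊢; exact h1
  · have hcn : s.reg 6 = n := le_antisymm h.cur_le (not_lt.mp hc)
    rw [hcn] at h
    have h1 := h.next (by omega) hS.le_sq
    have h2 := Auction.next_potential (K := K) (deg := s.arr 8) (p := s.arr 5) (d := s.arr 6) (ptr := s.arr 7) (show s.reg 5 < n by omega)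
    have eq : (s.reg 5 + 1) % 2 ^ w = s.reg 5 + 1 := mod_word hw (by omega)
    subst hs'
    simp [auctionStep, Prog.exec, hS.reg0, hc, eq, e1]
    exact ⟨h1, h2⟩

theorem does_auction (hS : Sizes w n m K s)
    (hA : AdjLists n m (s.arr 8) (s.arr 9) (s.arr 10)) :
    Does w auction s ((K * (m + 2 * n) + n) * 80 + n * 26 + 20) fun s' =>
      MatchArrays n (s.arr 10) (s'.arr 3) (s'.arr 4) ∧
      ∀ mA' mB', MatchArrays n (s.arr 10) mA' mB' →
        freeCount n (s'.arr 4) ≤ freeCount n mB' + K := by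
  refine ((does_auctionReset hS).seq fun s₁ f₁ h₁ => (Does.loop_straight (by rfl)
    (K * (m + 2 * n) + n)
    (fun s' => Auction n m K (s.arr 8) (s.arr 9) (s.arr 10) (s'.arr 3) (s'.arr 4) (s'.arr 5)
      (s'.arr 6) (s'.arr 7) (s'.reg 5) (s'.reg 6))
    (fun s' => auctionPotential n K (s.arr 8) (s'.arr 5) (s'.arr 6) (s'.arr 7) (s'.reg 5))
    ?_ (Auction.potential_le hA _) fun s₂ f₂ h₂ hg => ?_)).mono ?_ fun s' f h => ?_
  · rw [h₁.2.1, h₁.2.2]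
    exact Auction.start (fun i hi => (h₁.1 i hi).1) (fun i hi => (h₁.1 i hi).2.1)
      (fun i hi => (h₁.1 i hi).2.2.1) (fun i hi => (h₁.1 i hi).2.2.2.1)
      (fun i hi => (h₁.1 i hi).2.2.2.2)
  · have hS₂ := (hS.of_frame f₁).of_frame f₂
    have a8 : s₂.arr 8 = s.arr 8 := (f₂.arr 8 (by decide)).trans (f₁.arr 8 (by decide))
    have a9 : s₂.arr 9 = s.arr 9 := (f₂.arr 9 (by decide)).trans (f₁.arr 9 (by decide))
    have a10 : s₂.arr 10 = s.arr 10 := (f₂.arr 10 (by decide)).trans (f₁.arr 10 (by decide))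
    rw [← a8, ← a9, ← a10] at h₂ hA ⊢
    refine auctionStep_correct hS₂ hA h₂ ?_ rfl
    have e1 : (n + n) % 2 ^ w = n + n := mod_word hS.word (by nlinarith)
    have e2 : (s₂.reg 5 + s₂.reg 6) % 2 ^ w = s₂.reg 5 + s₂.reg 6 :=
      mod_word hS.word (by nlinarith [h₂.q_le, h₂.cur_le])
    simpa [hS₂.reg0, e1, e2] using hg
  · simp [Prog.maxCost, auctionStep, Exp.cost]
    omega
  · have hS' := hS.of_frame f
    obtain ⟨h, hg⟩ := h
    have e1 : (n + n) % 2 ^ w = n + n := mod_word hS.word (by nlinarith)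
    have e2 : (s'.reg 5 + s'.reg 6) % 2 ^ w = s'.reg 5 + s'.reg 6 :=
      mod_word hS.word (by nlinarith [h.q_le, h.cur_le])
    simp [hS'.reg0, e1, e2] at hg
    have h1 := h.q_le
    have h2 := h.cur_le
    have hq : s'.reg 5 = n := by omega
    have hc : s'.reg 6 = n := by omega
    rw [hq, hc] at h
    exact ⟨h.mat, fun mA' mB' h' => h.near_optimal hS.le_sq h'⟩

end

/-! ### Search and augmentation as programs. -/

/-- Set register `10` to the least free object, or to `n` if there is none. -/
def findFree : Prog :=
  .set 10 (.const 0) ;;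
    -- The product serves as a conjunction. Both factors are always evaluated, so cell `n` may be
    -- read, but then the first factor is $0$.
    .loop ((X 10).less (X 0) * (Exp.get 4 (X 10)).less (X 0)) (.set 10 (X 10 + .const 1))

/-- Set up the arrays for a search from the object in register `10`. -/
def searchReset : Prog :=
  .set 4 (.const 0) ;; .loop ((X 4).less (X 0))
    (.store 13 (X 4) (X 0) ;; .store 7 (X 4) (.const 0) ;; .set 4 (X 4 + .const 1)) ;;
  .store 14 (.const 0) (X 10) ;; .set 11 (.const 0) ;; .set 12 (.const 1) ;; .set 13 (X 0)

/-- One step of the search. -/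
def searchStep : Prog :=
  .set 8 (.get 14 (X 11)) ;;
  .cond ((Exp.get 7 (X 8)).less (.get 8 (X 8)))
    (.set 7 (.get 9 (X 8 * X 1 + .get 7 (X 8))) ;;
      .store 7 (X 8) (.get 7 (X 8) + .const 1) ;;
      .cond ((Exp.get 10 (X 7 * X 0 + X 8)).equal (.const 0)) .skip
        (.cond ((Exp.get 13 (X 7)).equal (X 0))
          (.store 13 (X 7) (X 8) ;;
            .cond ((Exp.get 3 (X 7)).less (X 0))
              (.store 14 (X 12) (.get 3 (X 7)) ;; .set 12 (X 12 + .const 1))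
              (.set 13 (X 7)))
          .skip))
    (.set 11 (X 11 + .const 1))

/-- Breadth-first search for an augmenting path from the free object in register `10`. -/
def search : Prog :=
  searchReset ;; .loop ((X 11).less (X 12) * (X 13).equal (X 0)) searchStep

/-- Exchange the path that ends in the agent in register `13`. -/
def exchange : Prog :=
  .loop ((X 13).less (X 0))
    -- At the root register `7` receives `n`: the write to array `3` then falls outside the range in
    -- use, and the final assignment ends the loop.
    (.set 8 (.get 13 (X 13)) ;; .set 7 (.get 4 (X 8)) ;; .store 3 (X 7) (X 0) ;;
      .store 3 (X 13) (X 8) ;; .store 4 (X 8) (X 13) ;; .set 13 (X 7))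

/-- Augment the matching until it is perfect or a search fails. -/
def augment : Prog :=
  .set 9 (.const 0) ;; .loop ((X 9).equal (.const 0))
    (findFree ;; .cond ((X 10).less (X 0))
      (search ;; .cond ((X 13).less (X 0)) exchange (.set 9 (.const 2)))
      (.set 9 (.const 1)))

section

variable {w n m K : ℕ} {s : State}

theorem does_findFree (hS : Sizes w n m K s) :
    Does w findFree s (n * 13 + 12) fun s' => s'.reg 10 ≤ n ∧
      (∀ b < s'.reg 10, s.arr 4 b < n) ∧ (s'.reg 10 < n → n ≤ s.arr 4 (s'.reg 10)) := by
  have e0 : 0 % 2 ^ w = 0 := Nat.zero_mod _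
  have e1 : 1 % 2 ^ w = 1 := mod_word hS.word (by omega)
  refine (Does.straight_seq (by rfl) fun s₁ f₁ h₁ => Does.loop_straight (by rfl) n
    (fun s' => s'.reg 10 ≤ n ∧ ∀ b < s'.reg 10, s.arr 4 b < n) (fun s' => n - s'.reg 10)
    (by simp [h₁, Prog.exec]) (by omega) fun s₂ f₂ ⟨h, h'⟩ hg => ?_).mono ?_ fun s' f h => ?_
  · have hS₂ := (hS.of_frame f₁).of_frame f₂
    have a4 : s₂.arr 4 = s.arr 4 := (f₂.arr 4 (by decide)).trans (f₁.arr 4 (by decide))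
    have ei : (s₂.reg 10 + 1) % 2 ^ w = s₂.reg 10 + 1 := mod_word hS.word (by nlinarith)
    by_cases g1 : s₂.reg 10 < n
    · by_cases g2 : s.arr 4 (s₂.reg 10) < n
      · simp [Prog.exec, e1, ei]
        refine ⟨⟨g1, fun b hb => ?_⟩, by omega⟩
        rcases Nat.le_iff_lt_or_eq.mp hb with hb | rfl
        · exact h' b hb
        · exact g2
      · simp [hS₂.reg0, g1, a4, g2] at hg
    · simp [hS₂.reg0, g1] at hg
  · simp [Prog.maxCost, Exp.cost]
    omega
  · have hS' := hS.of_frame f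
    have a4 : s'.arr 4 = s.arr 4 := f.arr 4 (by decide)
    obtain ⟨⟨h, h'⟩, hg⟩ := h
    refine ⟨h, h', fun hlt => ?_⟩
    by_contra hn
    simp [hS'.reg0, hlt, a4, not_le.mp hn, e1] at hg

theorem does_searchReset (hS : Sizes w n m K s) :
    Does w searchReset s (n * 20 + 20) fun s' =>
      (∀ i < n, s'.arr 13 i = n ∧ s'.arr 7 i = 0) ∧ s'.arr 14 0 = s.reg 10 ∧ s'.reg 11 = 0 ∧
        s'.reg 12 = 1 ∧ s'.reg 13 = n := by
  have hw := hS.word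
  have e0 : 0 % 2 ^ w = 0 := Nat.zero_mod _
  have e1 : 1 % 2 ^ w = 1 := mod_word hw (by omega)
  refine (Does.straight_seq (by rfl) fun s₁ f₁ h₁ => (Does.loop_straight (by rfl) n
      (fun s' => s'.reg 4 ≤ n ∧ ∀ i < s'.reg 4, s'.arr 13 i = n ∧ s'.arr 7 i = 0)
      (fun s' => n - s'.reg 4)
      (by simp [h₁, Prog.exec]) (by omega) fun s f ⟨h, h'⟩ hg => ?_).seq
      (fun s₂ f₂ h₂ => Does.straight (by rfl) ?_)).mono ?_ (fun _ _ h => h)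
  · have hS' := (hS.of_frame f₁).of_frame f
    simp [hS'.reg0] at hg
    have ei : (s.reg 4 + 1) % 2 ^ w = s.reg 4 + 1 := mod_word hw (by nlinarith)
    simp [Prog.exec, hS'.reg0, e1, ei]
    refine ⟨⟨hg, fun i hi => ?_⟩, by omega⟩
    rcases eq_or_ne i (s.reg 4) with rfl | hne
    · simp
    · simpa [hne] using h' i (by omega)
  · have hS₂ := (hS.of_frame f₁).of_frame f₂
    obtain ⟨⟨h, h'⟩, hg⟩ := h₂
    simp [hS₂.reg0] at hg
    have r10 : s₂.reg 10 = s.reg 10 := (f₂.reg 10 (by decide)).trans (f₁.reg 10 (by decide))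
    simp [Prog.exec, hS₂.reg0, r10, e1]
    exact fun i hi => h' i (by omega)
  · simp [Prog.maxCost, Exp.cost]
    omega

theorem searchStep_correct (hS : Sizes w n m K s)
    (hA : AdjLists n m (s.arr 8) (s.arr 9) (s.arr 10))
    (hM : MatchArrays n (s.arr 10) (s.arr 3) (s.arr 4))
    (h : Search n m (s.arr 8) (s.arr 9) (s.arr 10) (s.arr 3) (s.arr 4) (s.reg 10) (s.arr 13)
      (s.arr 7) (s.arr 14) (s.reg 11) (s.reg 12) n) (hg : s.reg 11 < s.reg 12)
    (hf : s.reg 13 = n) {s' : State} (hs' : s' = searchStep.exec w s) :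
    Search n m (s.arr 8) (s.arr 9) (s.arr 10) (s.arr 3) (s.arr 4) (s.reg 10) (s'.arr 13)
      (s'.arr 7) (s'.arr 14) (s'.reg 11) (s'.reg 12) (s'.reg 13) ∧
    searchPotential n (s.arr 8) (s'.arr 7) (s'.arr 13) (s'.reg 11) (s'.reg 12) <
      searchPotential n (s.arr 8) (s.arr 7) (s.arr 13) (s.reg 11) (s.reg 12) := by
  have hw := hS.word
  have hn : n ≤ n * n := Nat.le_mul_self n
  have hm := hS.m_le
  have e0 : 0 % 2 ^ w = 0 := Nat.zero_mod _
  have e1 : 1 % 2 ^ w = 1 := mod_word hw (by omega)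
  have htl := h.tail_le
  have eh : (s.reg 11 + 1) % 2 ^ w = s.reg 11 + 1 := mod_word hw (by omega)
  have et : (s.reg 12 + 1) % 2 ^ w = s.reg 12 + 1 := mod_word hw (by omega)
  obtain ⟨b, hb⟩ : ∃ b, s.arr 14 (s.reg 11) = b := ⟨_, rfl⟩
  have hbn : b < n := hb ▸ h.queue_lt _ hg
  have hdeg := hA.deg_le hbn
  subst hs'
  by_cases hj : s.arr 7 b < s.arr 8 b
  · have ei : (b * m % 2 ^ w + s.arr 7 b) % 2 ^ w = b * m + s.arr 7 b :=
      mod_word_index hw hbn.le hm (by omega)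
    have ep : (s.arr 7 b + 1) % 2 ^ w = s.arr 7 b + 1 := mod_word hw (by omega)
    have ha := hA.nbr_lt _ hbn _ hj
    obtain ⟨a, hadef⟩ : ∃ a, s.arr 9 (b * m + s.arr 7 b) = a := ⟨_, rfl⟩
    rw [hadef] at ha
    have ej := mod_word_index hw ha.le hn (hbn.le.trans hn)
    have hpot := Search.advance_potential (par := s.arr 13) (head := s.reg 11) (tail := s.reg 12)
      hbn hj
    by_cases hok : s.arr 10 (a * n + b) = 0
    · have h1 := h.advance hj (.inl (by rw [hadef]; exact hok))
      simp [searchStep, Prog.exec, hS.reg0, hS.reg1, hb, hj, ei, ep, e0, e1, hadef, ej, hok]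
      rw [hf]
      exact ⟨h1, hpot⟩
    · by_cases hpa : s.arr 13 a = n
      · have h1 := h.discover hM ha hg hb hok hpa
        have hU := freeCount_update ha hpa hbn.ne
        -- The program moves the list pointer before it inspects the agent. Here the discovery comes
        -- first, so that the advance may use that the agent is already discovered.
        have hpar : Function.update (s.arr 13) a b (s.arr 9 (b * m + s.arr 7 b)) ≠ n := by
          rw [hadef]; simpa using hbn.ne
        by_cases hma : s.arr 3 a < n
        · rw [if_pos hma] at h1
          have h2 := h1.advance hj (.inr hpar)
          simp [searchStep, Prog.exec, hS.reg0, hS.reg1, hb, hj, ei, ep, e1, hadef, ej, hok,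
            hpa, hma, et, e0]
          rw [hf]
          refine ⟨h2, ?_⟩
          unfold searchPotential at hpot ⊢
          omega
        · rw [if_neg hma] at h1
          have h2 := h1.advance hj (.inr hpar)
          simp [searchStep, Prog.exec, hS.reg0, hS.reg1, hb, hj, ei, ep, e1, hadef, ej, hok,
            hpa, hma, e0]
          refine ⟨h2, ?_⟩
          unfold searchPotential at hpot ⊢
          omega
      · have h1 := h.advance hj (.inr (by rw [hadef]; exact hpa))
        simp [searchStep, Prog.exec, hS.reg0, hS.reg1, hb, hj, ei, ep, e0, e1, hadef, ej, hok, hpa]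
        rw [hf]
        exact ⟨h1, hpot⟩
  · have h1 := h.pop hg (by rw [hb]; omega)
    simp [searchStep, Prog.exec, hb, hj, e1, eh]
    rw [hf]
    refine ⟨h1, ?_⟩
    unfold searchPotential
    omega

theorem does_search (hS : Sizes w n m K s)
    (hA : AdjLists n m (s.arr 8) (s.arr 9) (s.arr 10))
    (hM : MatchArrays n (s.arr 10) (s.arr 3) (s.arr 4))
    (hb₀ : s.reg 10 < n) (hfree : s.arr 4 (s.reg 10) = n) :
    Does w search s ((m + n + 1) * 80 + n * 20 + 40) fun s' => s'.reg 13 ≤ n ∧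
      (s'.reg 13 = n → ∃ R : Set ℕ, s.reg 10 ∈ R ∧ ∀ b ∈ R, b < n ∧
        ∀ a < n, s.arr 10 (a * n + b) ≠ 0 → s.arr 3 a ≠ n ∧ s.arr 3 a ∈ R) ∧
      (s'.reg 13 < n → ∃ rk : ℕ → ℕ, rk (s'.reg 13) ≤ n ∧ Augmenting n (s.arr 10) (s.arr 3)
        (s.arr 4) (s'.arr 13) rk (s.reg 10) (freeCount n (s.arr 4)) (s'.reg 13)) := by
  have e1 : 1 % 2 ^ w = 1 := mod_word hS.word (by omega)
  refine ((does_searchReset hS).seq fun s₁ f₁ h₁ => (Does.loop_straight (by rfl) (m + n + 1)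
    (fun s' => Search n m (s.arr 8) (s.arr 9) (s.arr 10) (s.arr 3) (s.arr 4) (s.reg 10)
      (s'.arr 13) (s'.arr 7) (s'.arr 14) (s'.reg 11) (s'.reg 12) (s'.reg 13))
    (fun s' => searchPotential n (s.arr 8) (s'.arr 7) (s'.arr 13) (s'.reg 11) (s'.reg 12))
    ?_ ?_ fun s₂ f₂ h₂ hg => ?_)).mono ?_ fun s' f h => ?_
  · rw [h₁.2.2.1, h₁.2.2.2.1, h₁.2.2.2.2]
    exact Search.start hb₀ (fun i hi => (h₁.1 i hi).1) (fun i hi => (h₁.1 i hi).2) h₁.2.1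
  · have : ∑ b ∈ Finset.range n, (s.arr 8 b - s₁.arr 7 b) ≤ m :=
      (Finset.sum_le_sum fun b _ => Nat.sub_le _ _).trans hA.deg_sum.le
    have := freeCount_le n (s₁.arr 13)
    unfold searchPotential
    rw [h₁.2.2.1, h₁.2.2.2.1]
    omega
  · have hS₂ := (hS.of_frame f₁).of_frame f₂
    have hf : s₂.reg 13 = n := by
      by_contra hne
      simp [hS₂.reg0, hne] at hg
    have hlt : s₂.reg 11 < s₂.reg 12 := by
      by_contra hne
      simp [hne] at hg
    have a3 : s₂.arr 3 = s.arr 3 := (f₂.arr 3 (by decide)).trans (f₁.arr 3 (by decide))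
    have a4 : s₂.arr 4 = s.arr 4 := (f₂.arr 4 (by decide)).trans (f₁.arr 4 (by decide))
    have a8 : s₂.arr 8 = s.arr 8 := (f₂.arr 8 (by decide)).trans (f₁.arr 8 (by decide))
    have a9 : s₂.arr 9 = s.arr 9 := (f₂.arr 9 (by decide)).trans (f₁.arr 9 (by decide))
    have a10 : s₂.arr 10 = s.arr 10 := (f₂.arr 10 (by decide)).trans (f₁.arr 10 (by decide))
    have r10 : s₂.reg 10 = s.reg 10 := (f₂.reg 10 (by decide)).trans (f₁.reg 10 (by decide))
    rw [hf] at h₂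
    rw [← a3, ← a4, ← a8, ← a9, ← a10, ← r10] at h₂
    rw [← a3, ← a4, ← a10] at hM
    rw [← a8, ← a9, ← a10] at hA
    rw [← a3, ← a4, ← a8, ← a9, ← a10, ← r10]
    exact searchStep_correct hS₂ hA hM h₂ hlt hf rfl
  · simp [Prog.maxCost, searchStep, Exp.cost]
    omega
  · have hS' := hS.of_frame f
    obtain ⟨h, hg⟩ := h
    by_cases hf : s'.reg 13 = n
    · refine ⟨hf.le, fun _ => ?_, fun hlt => absurd hf hlt.ne⟩
      have hle := h.head_le
      have : s'.reg 11 = s'.reg 12 := by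
        by_contra hne
        have : s'.reg 11 < s'.reg 12 := by omega
        simp [hS'.reg0, hf, this, e1] at hg
      rw [hf, this] at h
      exact h.closed hA
    · have := h.found_free hf
      exact ⟨this.1.le, fun he => absurd he hf, fun _ => h.augmenting hf hM hb₀ hfree⟩

theorem does_exchange (hS : Sizes w n m K s) {rk : ℕ → ℕ} {b₀ F : ℕ} {ok : ℕ → ℕ}
    (h : Augmenting n ok (s.arr 3) (s.arr 4) (s.arr 13) rk b₀ F (s.reg 13))
    (hrk : rk (s.reg 13) ≤ n) (hlt : s.reg 13 < n) :
    Does w exchange s ((n + 1) * 40 + 10) fun s' =>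
      MatchArrays n ok (s'.arr 3) (s'.arr 4) ∧ freeCount n (s'.arr 4) + 1 = F := by
  refine (Does.loop_straight (by rfl) (n + 1)
    (fun s' => Augmenting n ok (s'.arr 3) (s'.arr 4) (s.arr 13) rk b₀ F (s'.reg 13))
    -- The rank falls along the path; the added one leaves room for the last step, after which
    -- register `13` is `n`.
    (fun s' => if s'.reg 13 < n then rk (s'.reg 13) + 1 else 0)
    h (by simp [hlt, hrk]) fun s₂ f₂ h₂ hg => ?_).mono ?_ fun s' f h => ?_
  · have hS₂ := hS.of_frame f₂
    have a13 : s₂.arr 13 = s.arr 13 := f₂.arr 13 (by decide)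
    simp [hS₂.reg0] at hg
    obtain ⟨h1, h2, h3, h4⟩ := h₂.step hg
    simp [Prog.exec, hS₂.reg0, a13, hg]
    refine ⟨h2, ?_⟩
    split_ifs with hc
    · have := h3 hc
      omega
    · omega
  · simp [Prog.maxCost, Exp.cost]
    omega
  · have hS' := hS.of_frame f
    obtain ⟨⟨hM, h⟩, hg⟩ := h
    simp [hS'.reg0] at hg
    exact ⟨hM, by rcases h with h | h <;> omega⟩

/-- Each successful search reduces the number of free objects by one, and near-optimality allows at
most `K` of these; one more iteration detects perfection or a failed search. -/
theorem does_augment (hS : Sizes w n m K s)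
    (hA : AdjLists n m (s.arr 8) (s.arr 9) (s.arr 10))
    (hM : MatchArrays n (s.arr 10) (s.arr 3) (s.arr 4))
    (hopt : ∀ mA' mB', MatchArrays n (s.arr 10) mA' mB' →
        freeCount n (s.arr 4) ≤ freeCount n mB' + K) :
    Does w augment s ((K + 1) * ((m + n + 1) * 300) + 10) fun s' =>
      MatchArrays n (s.arr 10) (s'.arr 3) (s'.arr 4) ∧
        (s'.reg 9 = 1 ∧ (∀ b < n, s'.arr 4 b ≠ n) ∨
          s'.reg 9 = 2 ∧ s'.reg 10 < n ∧ s'.arr 4 (s'.reg 10) = n ∧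
            ∃ R : Set ℕ, s'.reg 10 ∈ R ∧ ∀ b ∈ R, b < n ∧
              ∀ a < n, s.arr 10 (a * n + b) ≠ 0 → s'.arr 3 a ≠ n ∧ s'.arr 3 a ∈ R) := by
  have e0 : 0 % 2 ^ w = 0 := Nat.zero_mod _
  have e1 : 1 % 2 ^ w = 1 := mod_word hS.word (by omega)
  have e2 : 2 % 2 ^ w = 2 := mod_word hS.word (by omega)
  refine (Does.straight_seq (by rfl) fun s₁ f₁ h₁ => Does.loop (c := (m + n + 1) * 290) (K + 1)
    (fun s' => MatchArrays n (s.arr 10) (s'.arr 3) (s'.arr 4) ∧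
        (s'.reg 9 = 0 ∨ s'.reg 9 = 1 ∧ (∀ b < n, s'.arr 4 b ≠ n) ∨
          s'.reg 9 = 2 ∧ s'.reg 10 < n ∧ s'.arr 4 (s'.reg 10) = n ∧
            ∃ R : Set ℕ, s'.reg 10 ∈ R ∧ ∀ b ∈ R, b < n ∧
              ∀ a < n, s.arr 10 (a * n + b) ≠ 0 → s'.arr 3 a ≠ n ∧ s'.arr 3 a ∈ R))
    -- By `hopt` this truncated subtraction never truncates.
    (fun s' => freeCount n (s'.arr 4) + K - freeCount n (s.arr 4) +
      if s'.reg 9 = 0 then 1 else 0) ?_ ?_ fun s₂ f₂ h₂ hg => ?_).mono ?_ fun s' f h => ?_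
  · simp [h₁, Prog.exec, hM]
  · simp [h₁, Prog.exec]
  · have hS₂ := (hS.of_frame f₁).of_frame f₂
    have hf₂ := f₂
    have a8 : s₂.arr 8 = s.arr 8 := (f₂.arr 8 (by decide)).trans (f₁.arr 8 (by decide))
    have a9 : s₂.arr 9 = s.arr 9 := (f₂.arr 9 (by decide)).trans (f₁.arr 9 (by decide))
    have a10 : s₂.arr 10 = s.arr 10 := (f₂.arr 10 (by decide)).trans (f₁.arr 10 (by decide))
    have h9 : s₂.reg 9 = 0 := by
      by_contra hne
      simp [hne] at hg
    obtain ⟨hM₂, _⟩ := h₂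
    refine ((does_findFree hS₂).seq fun s₃ f₃ ⟨h3, h3', h3''⟩ => Does.cond
      (T := (n + 1) * 40 + 10 + ((m + n + 1) * 80 + n * 20 + 60)) (T' := 2) (fun hc => ?_)
      fun hc => ?_).mono ?_ fun _ _ h => h
    · have hS₃ := hS₂.of_frame f₃
      simp [hS₃.reg0] at hc
      have b3 : s₃.arr 3 = s₂.arr 3 := f₃.arr 3 (by decide)
      have b4 : s₃.arr 4 = s₂.arr 4 := f₃.arr 4 (by decide)
      have b8 : s₃.arr 8 = s.arr 8 := (f₃.arr 8 (by decide)).trans a8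
      have b9 : s₃.arr 9 = s.arr 9 := (f₃.arr 9 (by decide)).trans a9
      have b10 : s₃.arr 10 = s.arr 10 := (f₃.arr 10 (by decide)).trans a10
      have c9 : s₃.reg 9 = 0 := (f₃.reg 9 (by decide)).trans h9
      have hfree : s₃.arr 4 (s₃.reg 10) = n := by
        by_contra hne
        rw [b4] at hne
        have := (hM₂.object _ hc hne).1
        have := h3'' hc
        omega
      have hs := does_search hS₃ (by rwa [b8, b9, b10]) (by rwa [b10, b3, b4]) hc hfree
      refine (hs.seq fun s₄ f₄ ⟨h4, h4', h4''⟩ => Does.cond (T := (n + 1) * 40 + 10) (T' := 2)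
        (fun hc' => ?_) fun hc' => ?_).mono ?_ fun _ _ h => h
      · have hS₄ := hS₃.of_frame f₄
        simp [hS₄.reg0] at hc'
        obtain ⟨rk, hrk, haug⟩ := h4'' hc'
        have d3 : s₄.arr 3 = s₃.arr 3 := f₄.arr 3 (by decide)
        have d4 : s₄.arr 4 = s₃.arr 4 := f₄.arr 4 (by decide)
        have d9 : s₄.reg 9 = 0 := (f₄.reg 9 (by decide)).trans c9
        rw [← d3, ← d4, b10] at haug
        refine (does_exchange hS₄ haug hrk hc').mono le_rfl
          fun s₅ f₅ ⟨hM₅, h5⟩ => ?_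
        have g9 : s₅.reg 9 = 0 := (f₅.reg 9 (by decide)).trans d9
        have := hopt _ _ hM₅
        rw [d4, b4] at h5
        refine ⟨⟨hM₅, .inl g9⟩, ?_⟩
        simp [g9, h9]
        omega
      · have hS₄ := hS₃.of_frame f₄
        simp [hS₄.reg0] at hc'
        have hn : s₄.reg 13 = n := by omega
        have d3 : s₄.arr 3 = s₃.arr 3 := f₄.arr 3 (by decide)
        have d4 : s₄.arr 4 = s₃.arr 4 := f₄.arr 4 (by decide)
        have d10 : s₄.reg 10 = s₃.reg 10 := f₄.reg 10 (by decide)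
        have hR := h4' hn
        refine Does.straight (by rfl) ?_
        simp [Prog.exec, e2, d3, d4, d10, b3, b4, h9]
        rw [b4] at hfree
        rw [b10, b3] at hR
        exact ⟨hM₂, hc, hfree, hR⟩
      · simp [Exp.cost]
        omega
    · have hS₃ := hS₂.of_frame f₃
      simp [hS₃.reg0] at hc
      have hn : s₃.reg 10 = n := by omega
      have b3 : s₃.arr 3 = s₂.arr 3 := f₃.arr 3 (by decide)
      have b4 : s₃.arr 4 = s₂.arr 4 := f₃.arr 4 (by decide)
      refine Does.straight (by rfl) ?_
      simp [Prog.exec, e1, b3, b4, h9]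
      exact ⟨hM₂, fun b hb => (h3' b (by omega)).ne⟩
    · simp [Exp.cost]
      omega
  · simp [Prog.maxCost, Exp.cost]
    have : (m + n + 1) * 290 + 3 + 1 ≤ (m + n + 1) * 300 := by omega
    have := Nat.mul_le_mul_left (K + 1) this
    omega
  · obtain ⟨⟨h1, h2⟩, hg⟩ := h
    refine ⟨h1, h2.resolve_left fun h9 => ?_⟩
    simp [h9] at hg

end

/-! ### Adjacency lists and the table of tight edges. -/

theorem index_inj {k a b j i : ℕ} (hj : j < k) (hi : i < k) :
    a * k + j = b * k + i ↔ a = b ∧ j = i := by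
  constructor
  · intro h
    have h1 : a = b := by
      have := congrArg (· / k) h
      have hk : 0 < k := by omega
      simpa [Nat.add_comm (_ * k), Nat.add_mul_div_right _ _ hk, Nat.div_eq_of_lt hj,
        Nat.div_eq_of_lt hi] using this
    subst h1
    exact ⟨rfl, by omega⟩
  · rintro ⟨rfl, rfl⟩
    rfl

/-- The invariant of the construction of the adjacency lists and the edge table from the first `i`
edges `(ag 0, ob 0), …, (ag (i - 1), ob (i - 1))`. -/
structure PartialLists (n m : ℕ) (ag ob deg nbr adj : ℕ → ℕ) (i : ℕ) : Prop where
  listed_edge : ∀ b < n, ∀ j < deg b, ∃ k < i, ob k = b ∧ ag k = nbr (b * m + j)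
  edge_listed : ∀ k < i, ∃ j < deg (ob k), nbr (ob k * m + j) = ag k
  deg_sum : ∑ b ∈ Finset.range n, deg b = i
  adj_iff : ∀ a < n, ∀ b < n, adj (a * n + b) ≠ 0 ↔ ∃ k < i, ag k = a ∧ ob k = b

theorem PartialLists.step {n m : ℕ} {ag ob deg nbr adj : ℕ → ℕ} {i : ℕ}
    (h : PartialLists n m ag ob deg nbr adj i)
    (hob : ∀ k < m, ob k < n) (hi : i < m) :
    PartialLists n m ag ob (Function.update deg (ob i) (deg (ob i) + 1))
      (Function.update nbr (ob i * m + deg (ob i)) (ag i))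
      (Function.update adj (ag i * n + ob i) 1) (i + 1) := by
  -- Each object owns a block of `m` cells; as fewer than `m` edges have been read, the next entry
  -- still fits in its block.
  have hdeg : ∀ b < n, deg b < m := fun b hb => by
    have := Finset.single_le_sum (f := deg) (fun _ _ => Nat.zero_le _) (Finset.mem_range.mpr hb)
    rw [h.deg_sum] at this
    omega
  have hnbr : ∀ b < n, ∀ j < deg b,
      Function.update nbr (ob i * m + deg (ob i)) (ag i) (b * m + j) = nbr (b * m + j) := by
    intro b hb j hj
    refine Function.update_of_ne (fun he => ?_) _ _
    have := (index_inj (hj.trans (hdeg b hb)) (hdeg _ (hob i hi))).mp he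
    rw [this.1] at hj
    omega
  refine ⟨fun b hb j hj => ?_, fun k hk => ?_, ?_, fun a ha b hb => ?_⟩
  · rcases eq_or_ne b (ob i) with rfl | hne
    · rw [Function.update_self] at hj
      rcases Nat.lt_succ_iff_lt_or_eq.mp hj with hj | rfl
      · obtain ⟨k, hk, h1, h2⟩ := h.listed_edge _ hb j hj
        exact ⟨k, by omega, h1, by rw [hnbr _ hb j hj, h2]⟩
      · exact ⟨i, by omega, rfl, by simp⟩
    · rw [Function.update_of_ne hne] at hj
      obtain ⟨k, hk, h1, h2⟩ := h.listed_edge _ hb j hj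
      exact ⟨k, by omega, h1, by rw [hnbr _ hb j hj, h2]⟩
  · rcases Nat.lt_succ_iff_lt_or_eq.mp hk with hk | rfl
    · obtain ⟨j, hj, h1⟩ := h.edge_listed k hk
      refine ⟨j, ?_, by rw [hnbr _ (hob k (by omega)) j hj, h1]⟩
      rcases eq_or_ne (ob k) (ob i) with he | hne
      · rw [he, Function.update_self]; rw [he] at hj; omega
      · rwa [Function.update_of_ne hne]
    · exact ⟨deg (ob k), by simp, by simp⟩
  · have hmem : ob i ∈ Finset.range n := Finset.mem_range.mpr (hob i hi)
    have h1 := h.deg_sum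
    rw [← Finset.add_sum_erase _ _ hmem] at h1 ⊢
    rw [Finset.sum_congr rfl fun b hb =>
      Function.update_of_ne (Finset.ne_of_mem_erase hb) (deg (ob i) + 1) deg, Function.update_self]
    change deg (ob i) + 1 + ∑ x ∈ (Finset.range n).erase (ob i), deg x = i + 1
    omega
  · rw [Function.update_apply]
    have hidx := index_inj (a := a) (b := ag i) hb (hob i hi)
    constructor
    · intro h'
      split_ifs at h' with he
      · obtain ⟨rfl, rfl⟩ := hidx.mp he
        exact ⟨i, by omega, rfl, rfl⟩
      · obtain ⟨k, hk, h1⟩ := (h.adj_iff a ha b hb).mp h'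
        exact ⟨k, by omega, h1⟩
    · rintro ⟨k, hk, rfl, rfl⟩
      split_ifs with he
      · simp
      · rcases Nat.lt_succ_iff_lt_or_eq.mp hk with hk | rfl
        · exact (h.adj_iff _ ha _ hb).mpr ⟨k, hk, rfl, rfl⟩
        · exact absurd rfl he

/-- For the agent `a`, the object `b'` beats `b`: levels and preferences taken together count more
for `b'`. -/
def Beaten (n : ℕ) (lev pr : ℕ → ℕ) (a b b' : ℕ) : Prop :=
  lev b + pr ((a * n + b) * n + b') < lev b' + pr ((a * n + b') * n + b)

/-- The table `ok` records the tight edges; it need not do so for objects of level `0`. -/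
def TightTable {n : ℕ} (G : Market (Fin n) (Fin n)) (lev ok : ℕ → ℕ) : Prop :=
  (∀ a b : Fin n, ok (a * n + b) ≠ 0 → Tight G (fun b => lev b) a b) ∧
    ∀ a b : Fin n, 1 ≤ lev b → Tight G (fun b => lev b) a b → ok (a * n + b) ≠ 0

/-- The arrays `ag`, `ob`, `pr` are the input arrays for `G`. -/
structure Encodes {n : ℕ} (G : Market (Fin n) (Fin n)) (m : ℕ) (ag ob pr : ℕ → ℕ) : Prop where
  ag_lt : ∀ k < m, ag k < n
  ob_lt : ∀ k < m, ob k < n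
  edge : ∀ a b : Fin n, (a, b) ∈ G.E ↔ ∃ k < m, ag k = a ∧ ob k = b
  pref : ∀ a b b' : Fin n, pr ((a * n + b) * n + b') = pref01 G a b b'

/-- For $b\ne j$ an edge can only lose tightness when the level of $j$ rises, and only to $j$
itself, so the old entry and one comparison suffice. Edges at $j$ may become tight, so that column
restarts from the edge table and is compared with all edges of the agent. -/
theorem TightTable.raise {n m : ℕ} {G : Market (Fin n) (Fin n)} {ag ob pr lev ok ok' : ℕ → ℕ}
    (hG : Encodes G m ag ob pr) (h : TightTable G lev ok) {j : ℕ} (hj : j < n)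
    (hok : ∀ a < n, ∀ b < n, ok' (a * n + b) ≠ 0 ↔
      (if b = j then ∃ k < m, ag k = a ∧ ob k = j else ok (a * n + b) ≠ 0) ∧
        ∀ k < m, ag k = a → (∃ k < m, ag k = a ∧ ob k = j) →
          (b = j → ¬ Beaten n (Function.update lev j (lev j + 1)) pr a j (ob k)) ∧
          (b = ob k → ¬ Beaten n (Function.update lev j (lev j + 1)) pr a b j)) :
    TightTable G (Function.update lev j (lev j + 1)) ok' := by
  have hbeat : ∀ a b b' : Fin n, ¬ Beaten n (Function.update lev j (lev j + 1)) pr a b b' ↔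
      Function.update lev j (lev j + 1) b' + pref01 G a b' b ≤
        Function.update lev j (lev j + 1) b + pref01 G a b b' := fun a b b' => by
    rw [Beaten, hG.pref, hG.pref, not_lt]
  have hle : ∀ b, lev b ≤ Function.update lev j (lev j + 1) b := fun b => by
    rcases eq_or_ne b j with rfl | hb
    · simp
    · simp [hb]
  obtain ⟨j, rfl⟩ : ∃ j' : Fin n, (j' : ℕ) = j := ⟨⟨j, hj⟩, rfl⟩
  constructor
  · intro a b hab
    rw [hok a a.2 b b.2] at hab
    obtain ⟨h1, h2⟩ := hab
    rcases eq_or_ne b j with rfl | hbj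
    · rw [if_pos rfl] at h1
      refine ⟨(hG.edge a b).mpr h1, fun b' hb' => ?_⟩
      obtain ⟨k, hk, hka, hkb⟩ := (hG.edge a b').mp hb'
      have := (h2 k hk hka h1).1 rfl
      rw [hkb] at this
      exact (hbeat a b b').mp this
    · have hbj' : (b : ℕ) ≠ j := fun he => hbj (Fin.ext he)
      rw [if_neg hbj'] at h1
      have ht := h.1 a b h1
      refine ⟨ht.1, fun b' hb' => ?_⟩
      rcases eq_or_ne b' j with rfl | hb'j
      · obtain ⟨k, hk, hka, hkb⟩ := (hG.edge a b).mp ht.1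
        exact (hbeat a b b').mp ((h2 k hk hka ((hG.edge a b').mp hb')).2 hkb.symm)
      · have hb'j' : (b' : ℕ) ≠ j := fun he => hb'j (Fin.ext he)
        simpa [hbj', hb'j'] using ht.2 b' hb'
  · intro a b hb ht
    rw [hok a a.2 b b.2]
    refine ⟨?_, fun k hk hka hadj => ⟨fun hbj => ?_, fun hbk => ?_⟩⟩
    · split_ifs with hbj
      · have := (hG.edge a b).mp ht.1
        rwa [hbj] at this
      · rw [Function.update_of_ne hbj] at hb
        refine h.2 a b hb ⟨ht.1, fun b' hb' => ?_⟩
        have := ht.2 b' hb'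
        simp only [Function.update_of_ne hbj] at this
        have := hle b'
        show lev b' + _ ≤ lev b + _
        omega
    · obtain rfl : b = j := Fin.ext hbj
      exact (hbeat a b ⟨ob k, hG.ob_lt k hk⟩).mpr
        (ht.2 _ ((hG.edge a _).mpr ⟨k, hk, hka, rfl⟩))
    · exact (hbeat a b j).mpr (ht.2 j ((hG.edge a j).mpr hadj))

/-- A perfect matching of edges in a table of tight edges. -/
theorem TightTable.exists_equiv {n : ℕ} {G : Market (Fin n) (Fin n)} {lev ok mA mB : ℕ → ℕ}
    (h : TightTable G lev ok) (hM : MatchArrays n ok mA mB) (hB : ∀ b < n, mB b ≠ n) :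
    ∃ σ : Fin n ≃ Fin n, (∀ a, Tight G (fun b => lev b) a (σ a)) ∧
      ∀ a : Fin n, mA a = σ a := by
  let f : Fin n → Fin n := fun b => ⟨mB b, (hM.object b b.2 (hB b b.2)).1⟩
  have hf : ∀ b, mA (f b) = b := fun b => (hM.object b b.2 (hB b b.2)).2
  have hinj : Function.Injective f := fun b c hbc => by
    rw [Fin.ext_iff, ← hf b, ← hf c, hbc]
  let e := Equiv.ofBijective f ((Finite.injective_iff_bijective).mp hinj)
  have hmA : ∀ a : Fin n, mA a = e.symm a := fun a => by
    have := hf (e.symm a)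
    rwa [show f (e.symm a) = a from e.apply_symm_apply a] at this
  refine ⟨e.symm, fun a => h.1 a _ ?_, hmA⟩
  have h1 := (e.symm a).2
  rw [← hmA a] at h1 ⊢
  exact (hM.agent a a.2 (by omega)).2.2

/-- Transfers `IsTarget.lt_of_closed` to arrays, where the entry `n` plays the role of `none`. -/
theorem TightTable.lt_target {n : ℕ} {G : Market (Fin n) (Fin n)} {lev ok mA mB : ℕ → ℕ}
    (h : TightTable G lev ok) (hM : MatchArrays n ok mA mB) {L : Fin n → ℕ} (hL : IsTarget G L)
    (hle : ∀ b : Fin n, lev b ≤ L b) {R : Set ℕ} {b₀ : ℕ} (hb₀ : b₀ < n) (hfree : mB b₀ = n)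
    (hR : b₀ ∈ R) (hclosed : ∀ b ∈ R, b < n ∧
      ∀ a < n, ok (a * n + b) ≠ 0 → mA a ≠ n ∧ mA a ∈ R) : lev b₀ < L ⟨b₀, hb₀⟩ := by
  have hsome : ∀ a b : Fin n, (if h : mA a < n then some (⟨mA a, h⟩ : Fin n) else none) = some b ↔
      mA a = b := fun a b => by
    split_ifs with hlt
    · simp [Fin.ext_iff]
    · simp only [false_iff]
      have := b.2
      omega
  have hagent : ∀ a b : Fin n, mA a = b → mB b = a ∧ ok (a * n + b) ≠ 0 := fun a b he => by
    have h1 := hM.agent a a.2 (by have := b.2; omega)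
    rw [he] at h1
    exact h1.2
  refine hL.lt_of_closed (lev := fun b => lev b) hle (ok := fun a b => ok (a * n + b) ≠ 0)
    h.1 h.2 (R := {b | (b : ℕ) ∈ R})
    (mate := fun a => if h : mA a < n then some ⟨mA a, h⟩ else none)
    (fun a a' b h1 h2 => ?_) (fun a b h1 => (hagent a b ((hsome a b).mp h1)).2)
    (fun b hb a hab => ?_) (b₀ := ⟨b₀, hb₀⟩) hR (fun a ha => ?_)
  · rw [hsome] at h1 h2
    rw [Fin.ext_iff, ← (hagent a b h1).1, (hagent a' b h2).1]
  · obtain ⟨h1, h2⟩ := (hclosed b hb).2 a a.2 hab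
    exact ⟨⟨mA a, (hclosed _ h2).1⟩, h2, (hsome _ _).mpr rfl⟩
  · rw [hsome] at ha
    have h1 := (hagent a ⟨b₀, hb₀⟩ ha).1
    simp only [hfree] at h1
    have := a.2
    omega


/-! ### Programs for the cap, the lists and the tables. -/

/-- Compute the least `K` with `n ≤ K * K`. -/
def sqrtCap : Prog :=
  .set 2 (.const 0) ;; .loop ((X 2 * X 2).less (X 0)) (.set 2 (X 2 + .const 1))

/-- Compute the adjacency lists and the edge table. -/
def buildLists : Prog :=
  .set 4 (.const 0) ;; .loop ((X 4).less (X 1))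
    (.set 7 (.get 0 (X 4)) ;; .set 8 (.get 1 (X 4)) ;;
      .store 9 (X 8 * X 1 + .get 8 (X 8)) (X 7) ;;
      .store 8 (X 8) (.get 8 (X 8) + .const 1) ;;
      .store 11 (X 7 * X 0 + X 8) (.const 1) ;; .set 4 (X 4 + .const 1))

/-- Copy the column of the object in register `10` from the edge table to the table of tight
edges. -/
def copyColumn : Prog :=
  .set 4 (.const 0) ;; .loop ((X 4).less (X 0))
    (.store 10 (X 4 * X 0 + X 10) (.get 11 (X 4 * X 0 + X 10)) ;; .set 4 (X 4 + .const 1))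

/-- The sum of the level of the object in register `j` and the preference of the agent in
register `7` for it over the object in register `i`. -/
def score (j i : ℕ) : Exp :=
  .get 12 (X j) + .get 2 ((X 7 * X 0 + X j) * X 0 + X i)

/-- Compare, for the agent of an edge, its object with the object in register `10`. -/
def compareStep : Prog :=
  .set 7 (.get 0 (X 4)) ;; .set 8 (.get 1 (X 4)) ;;
    .cond (.get 11 (X 7 * X 0 + X 10))
      (.cond ((score 10 8).less (score 8 10)) (.store 10 (X 7 * X 0 + X 10) (.const 0)) .skip ;;
        .cond ((score 8 10).less (score 10 8)) (.store 10 (X 7 * X 0 + X 8) (.const 0)) .skip)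
      .skip ;;
    .set 4 (X 4 + .const 1)

/-- Remove from the table the edges that lose a comparison with the object in register `10`, and
the edges of this object that lose a comparison. -/
def compareEdges : Prog :=
  .set 4 (.const 0) ;; .loop ((X 4).less (X 1)) compareStep

/-- Update the table of tight edges after the level of the object in register `10` has been
raised. -/
def refresh : Prog := copyColumn ;; compareEdges

section

variable {w n m K : ℕ} {s : State}

theorem does_sqrtCap (hw : (n + 2) ^ 4 ≤ 2 ^ w) (h0 : s.reg 0 = n) :
    Does w sqrtCap s (n * 10 + 10) fun s' => n ≤ s'.reg 2 * s'.reg 2 ∧ s'.reg 2 ≤ n ∧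
      (s'.reg 2 = 0 ∨ (s'.reg 2 - 1) * (s'.reg 2 - 1) < n) := by
  have e0 : 0 % 2 ^ w = 0 := Nat.zero_mod _
  have e1 : 1 % 2 ^ w = 1 := mod_word hw (by omega)
  have key : ∀ s' : State, s'.reg 0 = n → s'.reg 2 ≤ n →
      (((X 2 * X 2).less (X 0)).eval w s' ≠ 0 ↔ s'.reg 2 * s'.reg 2 < n) := fun s' h h' => by
    have : s'.reg 2 * s'.reg 2 % 2 ^ w = s'.reg 2 * s'.reg 2 := mod_word hw (by nlinarith)
    simp [h, this]
  refine (Does.straight_seq (by rfl) fun s₁ f₁ h₁ => Does.loop_straight (by rfl) n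
    (fun s' => s'.reg 2 ≤ n ∧ (s'.reg 2 = 0 ∨ (s'.reg 2 - 1) * (s'.reg 2 - 1) < n))
    (fun s' => n - s'.reg 2) (by simp [h₁, Prog.exec]) (by omega)
    fun s₂ f₂ ⟨h, h'⟩ hg => ?_).mono ?_ fun s' f ⟨⟨h, h'⟩, hg⟩ => ?_
  · have r0 : s₂.reg 0 = n := by rw [f₂.reg 0 (by decide), f₁.reg 0 (by decide), h0]
    rw [key s₂ r0 h] at hg
    have hlt : s₂.reg 2 < n := by nlinarith
    have ei : (s₂.reg 2 + 1) % 2 ^ w = s₂.reg 2 + 1 := mod_word hw (by nlinarith)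
    simp [Prog.exec, e1, ei, hg]
    omega
  · simp [Prog.maxCost, Exp.cost]
    omega
  · have r0 : s'.reg 0 = n := by rw [f.reg 0 (by decide), h0]
    have := (not_congr (key s' r0 h)).mp (by simpa using hg)
    exact ⟨not_lt.mp this, h, h'⟩

theorem does_buildLists (hS : Sizes w n m K s) {G : Market (Fin n) (Fin n)}
    (hG : Encodes G m (s.arr 0) (s.arr 1) (s.arr 2)) (h8 : ∀ i, s.arr 8 i = 0)
    (h11 : ∀ i, s.arr 11 i = 0) :
    Does w buildLists s (m * 45 + 10) fun s' =>
      PartialLists n m (s.arr 0) (s.arr 1) (s'.arr 8) (s'.arr 9) (s'.arr 11) m := by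
  have hw := hS.word
  have hm := hS.m_le
  have hn : n ≤ n * n := Nat.le_mul_self n
  have e0 : 0 % 2 ^ w = 0 := Nat.zero_mod _
  have e1 : 1 % 2 ^ w = 1 := mod_word hw (by omega)
  refine (Does.straight_seq (by rfl) fun s₁ f₁ h₁ => Does.loop_straight (by rfl) m
    (fun s' => s'.reg 4 ≤ m ∧
      PartialLists n m (s.arr 0) (s.arr 1) (s'.arr 8) (s'.arr 9) (s'.arr 11) (s'.reg 4))
    (fun s' => m - s'.reg 4) ⟨by simp [h₁, Prog.exec], ?_⟩ (by omega)
    fun s₂ f₂ ⟨h, h'⟩ hg => ?_).mono ?_ fun s' f ⟨⟨h, h'⟩, hg⟩ => ?_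
  · simp [h₁, Prog.exec]
    exact ⟨fun b _ j hj => by simp [h8] at hj, fun k hk => absurd hk (by omega), by simp [h8],
      fun a _ b _ => by simp [h11]⟩
  · have hS₂ := (hS.of_frame f₁).of_frame f₂
    have a0 : s₂.arr 0 = s.arr 0 := (f₂.arr 0 (by decide)).trans (f₁.arr 0 (by decide))
    have a1 : s₂.arr 1 = s.arr 1 := (f₂.arr 1 (by decide)).trans (f₁.arr 1 (by decide))
    simp [hS₂.reg1] at hg
    have ha := hG.ag_lt _ hg
    have hb := hG.ob_lt _ hg
    have hdeg : s₂.arr 8 (s.arr 1 (s₂.reg 4)) ≤ s₂.reg 4 := by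
      have := Finset.single_le_sum (f := s₂.arr 8) (fun _ _ => Nat.zero_le _)
        (Finset.mem_range.mpr hb)
      rwa [h'.deg_sum] at this
    have ei : (s₂.reg 4 + 1) % 2 ^ w = s₂.reg 4 + 1 := mod_word hw (by omega)
    have ed : (s₂.arr 8 (s.arr 1 (s₂.reg 4)) + 1) % 2 ^ w = s₂.arr 8 (s.arr 1 (s₂.reg 4)) + 1 :=
      mod_word hw (by omega)
    have ej := mod_word_index hw ha.le hn (hb.le.trans hn)
    have ek := mod_word_index hw hb.le hm
      (show s₂.arr 8 (s.arr 1 (s₂.reg 4)) ≤ n * n by omega)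
    simp [Prog.exec, hS₂.reg0, hS₂.reg1, a0, a1, ei, ed, ej, ek, e1]
    exact ⟨⟨hg, h'.step hG.ob_lt hg⟩, by omega⟩
  · simp [Prog.maxCost, Exp.cost]
    omega
  · have hS' := hS.of_frame f
    simp [hS'.reg1] at hg
    rwa [show s'.reg 4 = m by omega] at h'

theorem does_copyColumn (hS : Sizes w n m K s) (hj : s.reg 10 < n) :
    Does w copyColumn s (n * 25 + 10) fun s' => ∀ a < n, ∀ b < n, s'.arr 10 (a * n + b) =
      if b = s.reg 10 then s.arr 11 (a * n + s.reg 10) else s.arr 10 (a * n + b) := by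
  have hw := hS.word
  have hn : n ≤ n * n := Nat.le_mul_self n
  have e0 : 0 % 2 ^ w = 0 := Nat.zero_mod _
  have e1 : 1 % 2 ^ w = 1 := mod_word hw (by omega)
  refine (Does.straight_seq (by rfl) fun s₁ f₁ h₁ => Does.loop_straight (by rfl) n
    (fun s' => s'.reg 4 ≤ n ∧ ∀ a < n, ∀ b < n, s'.arr 10 (a * n + b) =
      if a < s'.reg 4 ∧ b = s.reg 10 then s.arr 11 (a * n + s.reg 10) else s.arr 10 (a * n + b))
    (fun s' => n - s'.reg 4) (by simp [h₁, Prog.exec]) (by omega)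
    fun s₂ f₂ ⟨h, h'⟩ hg => ?_).mono ?_ fun s' f ⟨⟨h, h'⟩, hg⟩ => ?_
  · have hS₂ := (hS.of_frame f₁).of_frame f₂
    have a11 : s₂.arr 11 = s.arr 11 := (f₂.arr 11 (by decide)).trans (f₁.arr 11 (by decide))
    have r10 : s₂.reg 10 = s.reg 10 := (f₂.reg 10 (by decide)).trans (f₁.reg 10 (by decide))
    simp [hS₂.reg0] at hg
    have ei : (s₂.reg 4 + 1) % 2 ^ w = s₂.reg 4 + 1 := mod_word hw (by omega)
    have ej := mod_word_index hw hg.le hn (hj.le.trans hn)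
    simp [Prog.exec, hS₂.reg0, a11, r10, ei, ej, e1]
    refine ⟨⟨hg, fun a ha b hb => ?_⟩, by omega⟩
    rw [Function.update_apply, h' a ha b hb]
    have hidx := index_inj (a := a) (b := s₂.reg 4) hb hj
    by_cases hc : a = s₂.reg 4 ∧ b = s.reg 10
    · rw [if_pos (hidx.mpr hc), if_pos ⟨hc.1.le, hc.2⟩, hc.1]
    · rw [if_neg fun he => hc (hidx.mp he)]
      refine if_congr ?_ rfl rfl
      constructor
      · rintro ⟨h1, h2⟩
        exact ⟨h1.le, h2⟩
      · rintro ⟨h1, h2⟩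
        exact ⟨lt_of_le_of_ne h1 fun he => hc ⟨he, h2⟩, h2⟩
  · simp [Prog.maxCost, Exp.cost]
    omega
  · have hS' := hS.of_frame f
    simp [hS'.reg0] at hg
    intro a ha b hb
    rw [h' a ha b hb]
    simp [show a < s'.reg 4 by omega]

/-- One input edge of agent `a` stands for a neighbour to be compared with the raised object, if
that is also a neighbour of `a`. The loser's entry is cleared; at most one of the two can lose. -/
theorem compareStep_correct (hS : Sizes w n m K s) {G : Market (Fin n) (Fin n)}
    (hG : Encodes G m (s.arr 0) (s.arr 1) (s.arr 2)) (hj : s.reg 10 < n)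
    (hlev : ∀ b < n, s.arr 12 b ≤ n) (hi : s.reg 4 < m) {s' : State}
    (hs' : s' = compareStep.exec w s) :
    s'.reg 4 = s.reg 4 + 1 ∧ ∀ a < n, ∀ b < n, s'.arr 10 (a * n + b) ≠ 0 ↔
      s.arr 10 (a * n + b) ≠ 0 ∧
        (s.arr 0 (s.reg 4) = a → s.arr 11 (a * n + s.reg 10) ≠ 0 →
          (b = s.reg 10 → ¬ Beaten n (s.arr 12) (s.arr 2) a (s.reg 10) (s.arr 1 (s.reg 4))) ∧
          (b = s.arr 1 (s.reg 4) → ¬ Beaten n (s.arr 12) (s.arr 2) a b (s.reg 10))) := by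
  have hw := hS.word
  have hm := hS.m_le
  have hn : n ≤ n * n := Nat.le_mul_self n
  have e0 : 0 % 2 ^ w = 0 := Nat.zero_mod _
  have e1 : 1 % 2 ^ w = 1 := mod_word hw (by omega)
  have ei : (s.reg 4 + 1) % 2 ^ w = s.reg 4 + 1 := mod_word hw (by omega)
  obtain ⟨x, hx⟩ : ∃ x, s.arr 0 (s.reg 4) = x := ⟨_, rfl⟩
  obtain ⟨y, hy⟩ : ∃ y, s.arr 1 (s.reg 4) = y := ⟨_, rfl⟩
  obtain ⟨j, hjr⟩ : ∃ j, s.reg 10 = j := ⟨_, rfl⟩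
  have hxn : x < n := hx ▸ hG.ag_lt _ hi
  have hyn : y < n := hy ▸ hG.ob_lt _ hi
  rw [hjr] at hj
  have hpr : ∀ b < n, ∀ b' < n, s.arr 2 ((x * n + b) * n + b') ≤ 1 := fun b hb b' hb' => by
    have := hG.pref ⟨x, hxn⟩ ⟨b, hb⟩ ⟨b', hb'⟩
    simp only at this
    rw [this]
    unfold pref01
    split_ifs <;> omega
  have hidx : ∀ a b c, b < n → c < n → (a * n + b = x * n + c ↔ a = x ∧ b = c) :=
    fun a b c hb hc => index_inj hb hc
  have ej := mod_word_index hw hxn.le hn (hj.le.trans hn)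
  have ey := mod_word_index hw hxn.le hn (hyn.le.trans hn)
  have p1 := mod_word_index₃ hw hxn hj hyn
  have p2 := mod_word_index₃ hw hxn hyn hj
  rw [ej] at p1
  rw [ey] at p2
  have q1 : (s.arr 12 j + s.arr 2 ((x * n + j) * n + y)) % 2 ^ w =
      s.arr 12 j + s.arr 2 ((x * n + j) * n + y) := mod_word hw (by
    have := hlev j hj
    have := hpr j hj y hyn
    omega)
  have q2 : (s.arr 12 y + s.arr 2 ((x * n + y) * n + j)) % 2 ^ w =
      s.arr 12 y + s.arr 2 ((x * n + y) * n + j) := mod_word hw (by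
    have := hlev y hyn
    have := hpr y hyn j hj
    omega)
  subst hs'
  rw [hx, hy, hjr]
  by_cases hadj : s.arr 11 (x * n + j) = 0
  · simp [compareStep, Prog.exec, hS.reg0, hx, hy, hjr, ej, hadj, e1, ei]
    rintro a ha b hb - rfl h
    exact absurd hadj h
  · have hB1 : Beaten n (s.arr 12) (s.arr 2) x j y ↔ s.arr 12 j + s.arr 2 ((x * n + j) * n + y) <
      s.arr 12 y + s.arr 2 ((x * n + y) * n + j) := Iff.rfl
    have hB2 : Beaten n (s.arr 12) (s.arr 2) x y j ↔ s.arr 12 y + s.arr 2 ((x * n + y) * n + j) <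
      s.arr 12 j + s.arr 2 ((x * n + j) * n + y) := Iff.rfl
    by_cases hc1 : s.arr 12 j + s.arr 2 ((x * n + j) * n + y) <
      s.arr 12 y + s.arr 2 ((x * n + y) * n + j)
    · have hc2 := hc1.not_gt
      simp [compareStep, score, Prog.exec, hS.reg0, hx, hy, hjr, ej, ey, p1, p2, q1, q2, hadj, e0,
        e1, ei, hc1, hc2]
      intro a ha b hb
      simp only [Function.update_apply, hidx a b j hb hj]
      rcases eq_or_ne x a with rfl | hxa
      · by_cases hbj : b = j <;> by_cases hby : b = y <;> simp_all
      · simp [hxa, hxa.symm]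
    · by_cases hc2 : s.arr 12 y + s.arr 2 ((x * n + y) * n + j) <
        s.arr 12 j + s.arr 2 ((x * n + j) * n + y)
      · simp [compareStep, score, Prog.exec, hS.reg0, hx, hy, hjr, ej, ey, p1, p2, q1, q2, hadj,
          e0, e1, ei, hc1, hc2]
        intro a ha b hb
        simp only [Function.update_apply, hidx a b y hb hyn]
        rcases eq_or_ne x a with rfl | hxa
        · by_cases hbj : b = j <;> by_cases hby : b = y <;> simp_all
        · simp [hxa, hxa.symm]
      · simp [compareStep, score, Prog.exec, hS.reg0, hx, hy, hjr, ej, ey, p1, p2, q1, q2, hadj,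
          e1, ei, hc1, hc2]
        intro a ha b hb
        rcases eq_or_ne x a with rfl | hxa
        · by_cases hbj : b = j <;> by_cases hby : b = y <;> simp_all
        · simp [hxa]

theorem does_compareEdges (hS : Sizes w n m K s) {G : Market (Fin n) (Fin n)}
    (hG : Encodes G m (s.arr 0) (s.arr 1) (s.arr 2)) (hj : s.reg 10 < n)
    (hlev : ∀ b < n, s.arr 12 b ≤ n) :
    Does w compareEdges s (m * 100 + 20) fun s' => ∀ a < n, ∀ b < n,
      s'.arr 10 (a * n + b) ≠ 0 ↔ s.arr 10 (a * n + b) ≠ 0 ∧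
        ∀ k < m, s.arr 0 k = a → s.arr 11 (a * n + s.reg 10) ≠ 0 →
          (b = s.reg 10 → ¬ Beaten n (s.arr 12) (s.arr 2) a (s.reg 10) (s.arr 1 k)) ∧
          (b = s.arr 1 k → ¬ Beaten n (s.arr 12) (s.arr 2) a b (s.reg 10)) := by
  refine (Does.straight_seq (by rfl) fun s₂ f₂ h₂ => Does.loop_straight (by rfl) m
    (fun s' => s'.reg 4 ≤ m ∧ ∀ a < n, ∀ b < n, s'.arr 10 (a * n + b) ≠ 0 ↔
      s.arr 10 (a * n + b) ≠ 0 ∧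
        ∀ k < s'.reg 4, s.arr 0 k = a → s.arr 11 (a * n + s.reg 10) ≠ 0 →
          (b = s.reg 10 → ¬ Beaten n (s.arr 12) (s.arr 2) a (s.reg 10) (s.arr 1 k)) ∧
          (b = s.arr 1 k → ¬ Beaten n (s.arr 12) (s.arr 2) a b (s.reg 10)))
    (fun s' => m - s'.reg 4) (by simp [h₂, Prog.exec]) (by omega)
    fun s₃ f₃ ⟨h, h'⟩ hg => ?_).mono ?_ fun s' f h => ?_
  · have hS₃ := (hS.of_frame f₂).of_frame f₃
    have arr : ∀ i, i ≠ 10 → s₃.arr i = s.arr i := fun i hi => by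
      rw [f₃.arr i, f₂.arr i] <;> simp [Prog.arrs, compareStep, hi]
    have r10 : s₃.reg 10 = s.reg 10 := by
      rw [f₃.reg 10 (by decide), f₂.reg 10 (by decide)]
    simp [hS₃.reg1] at hg
    obtain ⟨h1, h2⟩ := compareStep_correct hS₃ (G := G)
      (by rwa [arr 0 (by decide), arr 1 (by decide), arr 2 (by decide)]) (by rwa [r10])
      (by rwa [arr 12 (by decide)]) hg rfl
    rw [arr 0 (by decide), arr 1 (by decide), arr 2 (by decide), arr 11 (by decide),
      arr 12 (by decide), r10] at h2
    refine ⟨⟨by omega, fun a ha b hb => ?_⟩, by omega⟩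
    rw [h2 a ha b hb, h' a ha b hb, and_assoc, h1]
    refine and_congr_right fun _ => ⟨fun ⟨k1, k2⟩ k hk => ?_, fun k1 => ⟨fun k hk => ?_, ?_⟩⟩
    · rcases Nat.lt_succ_iff_lt_or_eq.mp hk with hk | rfl
      · exact k1 k hk
      · exact k2
    · exact k1 k (by omega)
    · exact k1 _ (by omega)
  · simp [Prog.maxCost, Exp.cost, compareStep, score]
    omega
  · have hS' := hS.of_frame f
    obtain ⟨⟨h, h'⟩, hg⟩ := h
    simp [hS'.reg1] at hg
    rwa [show s'.reg 4 = m by omega] at h'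

/-- The arrays that describe the instance, and the adjacency lists and the edge table. -/
structure Instance (G : Market (Fin n) (Fin n)) (m : ℕ) (s : State) : Prop where
  enc : Encodes G m (s.arr 0) (s.arr 1) (s.arr 2)
  lists : PartialLists n m (s.arr 0) (s.arr 1) (s.arr 8) (s.arr 9) (s.arr 11) m

theorem Instance.of_frame {G : Market (Fin n) (Fin n)} {s s' : State} {p : Prog}
    (h : Instance G m s) (hf : Frame p s s') (h0 : 0 ∉ p.arrs := by decide)
    (h1 : 1 ∉ p.arrs := by decide) (h2 : 2 ∉ p.arrs := by decide) (h8 : 8 ∉ p.arrs := by decide)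
    (h9 : 9 ∉ p.arrs := by decide) (h11 : 11 ∉ p.arrs := by decide) : Instance G m s' := by
  obtain ⟨h, h'⟩ := h
  rw [← hf.arr 0 h0, ← hf.arr 1 h1] at h h'
  rw [← hf.arr 2 h2] at h
  rw [← hf.arr 8 h8, ← hf.arr 9 h9, ← hf.arr 11 h11] at h'
  exact ⟨h, h'⟩

/-- The lists contain all edges and are built only once; tight edges are edges, so the table merely
selects among the listed pairs in every round. -/
theorem Instance.adjLists {G : Market (Fin n) (Fin n)} (h : Instance G m s)
    (ht : TightTable G (s.arr 12) (s.arr 10)) :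
    AdjLists n m (s.arr 8) (s.arr 9) (s.arr 10) := by
  refine ⟨fun b hb j hj => ?_, fun a ha b hb hok => ?_, h.lists.deg_sum⟩
  · obtain ⟨k, hk, _, h1⟩ := h.lists.listed_edge b hb j hj
    rw [← h1]
    exact h.enc.ag_lt k hk
  · obtain ⟨k, hk, h1, h2⟩ := (h.enc.edge _ _).mp (ht.1 ⟨a, ha⟩ ⟨b, hb⟩ hok).1
    obtain ⟨j, hj, h3⟩ := h.lists.edge_listed k hk
    simp only at h1 h2
    rw [h2] at hj h3
    exact ⟨j, hj, h3.trans h1⟩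

/-- Raise the level of the object in register `10`. -/
def raiseLevel : Prog := .store 12 (X 10) (.get 12 (X 10) + .const 1) ;; refresh

theorem does_raiseLevel (hS : Sizes w n m K s) {G : Market (Fin n) (Fin n)}
    (hI : Instance G m s) (hT : TightTable G (s.arr 12) (s.arr 10)) (hj : s.reg 10 < n)
    (hlev : ∀ b < n, s.arr 12 b ≤ n) (hlt : s.arr 12 (s.reg 10) < n) :
    Does w raiseLevel s (n * 25 + m * 100 + 40) fun s' => TightTable G (s'.arr 12) (s'.arr 10) ∧
      s'.arr 12 = Function.update (s.arr 12) (s.reg 10) (s.arr 12 (s.reg 10) + 1) := by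
  have e1 : 1 % 2 ^ w = 1 := mod_word hS.word (by omega)
  have ei : (s.arr 12 (s.reg 10) + 1) % 2 ^ w = s.arr 12 (s.reg 10) + 1 :=
    mod_word hS.word (by nlinarith)
  have main : ∀ s₁, Frame (.store 12 (X 10) (.get 12 (X 10) + .const 1)) s s₁ →
      s₁ = Prog.exec w (.store 12 (X 10) (.get 12 (X 10) + .const 1)) s →
      Does w refresh s₁ (n * 25 + 10 + (m * 100 + 20)) fun s' =>
        TightTable G (s'.arr 12) (s'.arr 10) ∧
        s'.arr 12 = Function.update (s.arr 12) (s.reg 10) (s.arr 12 (s.reg 10) + 1) := by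
    intro s₁ f₁ h₁
    have hS₁ := hS.of_frame f₁
    have hI₁ := hI.of_frame f₁
    have r1 : s₁.reg 10 = s.reg 10 := f₁.reg 10 (by decide)
    have l1 : s₁.arr 12 = Function.update (s.arr 12) (s.reg 10) (s.arr 12 (s.reg 10) + 1) := by
      simp [h₁, Prog.exec, e1, ei]
    have o1 : s₁.arr 10 = s.arr 10 := f₁.arr 10 (by decide)
    refine (does_copyColumn hS₁ (by rwa [r1])).seq fun s₂ f₂ h₂ => ?_
    have hI₂ := hI₁.of_frame f₂
    have r2 : s₂.reg 10 = s.reg 10 := (f₂.reg 10 (by decide)).trans r1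
    have l2 : s₂.arr 12 = s₁.arr 12 := f₂.arr 12 (by decide)
    have t2 : s₂.arr 11 = s₁.arr 11 := f₂.arr 11 (by decide)
    refine (does_compareEdges (hS₁.of_frame f₂) hI₂.enc (by rwa [r2]) ?_).mono le_rfl
      fun s₃ f₃ h₃ => ?_
    · rw [l2, l1]
      intro b hb
      rcases eq_or_ne b (s.reg 10) with rfl | hne
      · simpa using hlt
      · simpa [hne] using hlev b hb
    · have l3 : s₃.arr 12 = s₂.arr 12 := f₃.arr 12 (by decide)
      rw [l3, l2, l1]
      refine ⟨hT.raise hI₂.enc hj fun a ha b hb => ?_, rfl⟩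
      have hadj := hI₂.lists.adj_iff a ha (s.reg 10) hj
      rw [h₃ a ha b hb, h₂ a ha b hb, r2, r1, l2, l1, o1, ← t2, hadj]
      refine and_congr_left fun _ => ?_
      split_ifs
      · exact hadj
      · rfl
  refine (Does.straight_seq (by rfl) main).mono ?_ fun _ _ h => h
  simp [Prog.maxCost, Exp.cost]
  omega

end

/-! ### The main loop. -/

/-- Find a matching of tight edges that is perfect or leaves an object free from which no
augmenting path starts. -/
def findMatching : Prog := auction ;; augment

/-- One round: compute a maximum matching of tight edges; stop if it is perfect, and otherwise raise
the level of an object that cannot be matched, unless the level is `n` already. -/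
def round : Prog :=
  findMatching ;;
    .cond ((X 9).equal (.const 1)) (.set 3 (.const 0) ;; .set 14 (.const 1))
      (.cond ((Exp.get 12 (X 10)).less (X 0)) raiseLevel (.set 3 (.const 0)))

/-- The algorithm for popular assignments. -/
def solve : Prog :=
  .cond ((X 1).less (X 0)) (.set 0 (.const 0))
    (sqrtCap ;; buildLists ;; .set 3 (.const 1) ;; .loop (X 3) round ;; .set 0 (X 14))

/-- Array `3` holds an assignment of edges that are tight for some levels. -/
def Solved {n : ℕ} (G : Market (Fin n) (Fin n)) (s : State) : Prop :=
  ∃ (l : Fin n → ℕ) (σ : Fin n ≃ Fin n), (∀ a, Tight G l a (σ a)) ∧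
    ∀ a : Fin n, s.arr 3 a = σ a

/-- The invariant of the main loop. -/
structure Rounds {n : ℕ} (G : Market (Fin n) (Fin n)) (s : State) : Prop where
  table : TightTable G (s.arr 12) (s.arr 10)
  lev_le : ∀ b < n, s.arr 12 b ≤ n
  below : ∀ L, IsTarget G L → ∀ b : Fin n, s.arr 12 b ≤ L b
  status : s.reg 3 = 1 ∧ s.reg 14 = 0 ∨
    s.reg 3 = 0 ∧ (s.reg 14 = 1 ∧ Solved G s ∨ s.reg 14 = 0 ∧ ¬ ∃ L, IsTarget G L)

/-- The potential of the main loop. -/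
def roundPotential (n : ℕ) (s : State) : ℕ :=
  ∑ b ∈ Finset.range n, (n - s.arr 12 b) + s.reg 3

section

variable {w n m K : ℕ} {s : State}

theorem does_findMatching (hS : Sizes w n m K s)
    (hA : AdjLists n m (s.arr 8) (s.arr 9) (s.arr 10)) :
    Does w findMatching s ((K + 1) * ((m + n + 1) * 600)) fun s' =>
      MatchArrays n (s.arr 10) (s'.arr 3) (s'.arr 4) ∧
        (s'.reg 9 = 1 ∧ (∀ b < n, s'.arr 4 b ≠ n) ∨
          s'.reg 9 = 2 ∧ s'.reg 10 < n ∧ s'.arr 4 (s'.reg 10) = n ∧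
            ∃ R : Set ℕ, s'.reg 10 ∈ R ∧ ∀ b ∈ R, b < n ∧
              ∀ a < n, s.arr 10 (a * n + b) ≠ 0 → s'.arr 3 a ≠ n ∧ s'.arr 3 a ∈ R) := by
  refine ((does_auction hS hA).seq fun s₁ f₁ h₁ =>
    (?_ : Does w augment s₁ ((K + 1) * ((m + n + 1) * 300) + 10) _)).mono ?_ fun _ _ h => h
  · have a8 : s₁.arr 8 = s.arr 8 := f₁.arr 8 (by decide)
    have a9 : s₁.arr 9 = s.arr 9 := f₁.arr 9 (by decide)
    have a10 : s₁.arr 10 = s.arr 10 := f₁.arr 10 (by decide)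
    obtain ⟨hM₁, hopt⟩ := h₁
    rw [← a10] at hM₁ hopt hA ⊢
    rw [← a8, ← a9] at hA
    exact does_augment (hS.of_frame f₁) hA hM₁ hopt
  · nlinarith [Nat.zero_le (K * m), Nat.zero_le (K * n)]

/-- A failed search puts the level of the free object strictly below every target: raising it by one
keeps `below`, and if it equals `n` no target exists, since targets are at most `n`. -/
theorem does_round (hS : Sizes w n m K s) {G : Market (Fin n) (Fin n)} (hI : Instance G m s)
    (h : Rounds G s) (hrun : s.reg 3 = 1) :
    Does w round s ((K + 1) * ((m + n + 1) * 1000)) fun s' => Rounds G s' ∧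
      roundPotential n s' < roundPotential n s := by
  have e0 : 0 % 2 ^ w = 0 := Nat.zero_mod _
  have e1 : 1 % 2 ^ w = 1 := mod_word hS.word (by omega)
  have h14 : s.reg 14 = 0 := by
    rcases h.status with h | h
    · exact h.2
    · omega
  have hA := hI.adjLists h.table
  refine ((does_findMatching hS hA).seq (T' := n * 25 + m * 100 + 60)
    fun s₂ f₂ h₂ => ?_).mono ?_ fun _ _ h => h
  · have hS₂ := hS.of_frame f₂
    have a10 : s₂.arr 10 = s.arr 10 := f₂.arr 10 (by decide)
    have a12 : s₂.arr 12 = s.arr 12 := f₂.arr 12 (by decide)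
    have r3 : s₂.reg 3 = 1 := (f₂.reg 3 (by decide)).trans hrun
    have r14 : s₂.reg 14 = 0 := (f₂.reg 14 (by decide)).trans h14
    have hI₂ := hI.of_frame f₂
    have ht := h.table
    have hlev := h.lev_le
    have hbelow := h.below
    obtain ⟨hM, h₂⟩ := h₂
    rw [← a10] at hM
    rw [← a10, ← a12] at ht
    rw [← a12] at hlev hbelow
    unfold roundPotential
    rw [← a12, hrun]
    rw [← a10] at h₂
    refine (Does.cond (T := 10) (T' := n * 25 + m * 100 + 50) (fun hc => ?_)
      fun hc => ?_).mono (by simp [Exp.cost]; omega) fun _ _ h => h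
    · have h9 : s₂.reg 9 = 1 := by
        by_contra hne
        simp [e1, hne] at hc
      have hB := (h₂.resolve_right (by omega)).2
      refine (Does.straight (by rfl) ?_).mono (T := _) (by simp [Prog.maxCost, Exp.cost])
        fun _ _ h => h
      obtain ⟨σ, h1, h2⟩ := ht.exists_equiv hM hB
      simp [Prog.exec, e0, e1]
      exact ⟨ht, hlev, hbelow, .inr ⟨by simp, .inl ⟨by simp, _, σ, h1, h2⟩⟩⟩
    · have h9 : s₂.reg 9 ≠ 1 := by
        intro he
        simp [e1, he] at hc
      obtain ⟨_, hj, hfree, R, hR, hcl⟩ := h₂.resolve_left (fun h => h9 h.1)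
      have hlt : ∀ L (hL : IsTarget G L), s₂.arr 12 (s₂.reg 10) < L ⟨s₂.reg 10, hj⟩ :=
        fun L hL => ht.lt_target hM hL (hbelow L hL) hj hfree hR hcl
      refine (Does.cond (T := n * 25 + m * 100 + 40) (T' := 2) (fun hc => ?_)
        fun hc => ?_).mono (by simp [Exp.cost]; omega) fun _ _ h => h
      · have hc' : s₂.arr 12 (s₂.reg 10) < n := by
          by_contra hne
          simp [hS₂.reg0, not_lt.mp hne] at hc
        refine (does_raiseLevel hS₂ hI₂ ht hj hlev hc').mono le_rfl fun s₃ f₃ ⟨h1, h2⟩ => ?_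
        have r3' : s₃.reg 3 = 1 := (f₃.reg 3 (by decide)).trans r3
        have r14' : s₃.reg 14 = 0 := (f₃.reg 14 (by decide)).trans r14
        refine ⟨⟨h1, ?_, fun L hL b => ?_, .inl ⟨r3', r14'⟩⟩, ?_⟩
        · rw [h2]
          intro b hb
          rcases eq_or_ne b (s₂.reg 10) with rfl | hne
          · simpa using hc'
          · simpa [hne] using hlev b hb
        · rw [h2]
          rcases eq_or_ne (b : ℕ) (s₂.reg 10) with he | hne
          · have := hlt L hL
            rw [he, Function.update_self]
            obtain rfl : b = ⟨s₂.reg 10, hj⟩ := Fin.ext he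
            exact this
          · simpa [hne] using hbelow L hL b
        · rw [h2, r3']
          have := sum_update_lt (f := s₂.arr 12) (v := s₂.arr 12 (s₂.reg 10) + 1) hj
            (fun _ x => n - x) (by omega)
          omega
      · have hc' : n ≤ s₂.arr 12 (s₂.reg 10) := by
          by_contra hne
          simp [hS₂.reg0, hne] at hc
        refine (Does.straight (by rfl) ?_).mono (T := _) (by simp [Prog.maxCost, Exp.cost])
          fun _ _ h => h
        simp [Prog.exec, e0]
        refine ⟨ht, hlev, hbelow, .inr ⟨by simp, .inr ⟨by simpa using r14, ?_⟩⟩⟩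
        rintro ⟨L, hL⟩
        have := hlt L hL
        have := (hL.1 ⟨s₂.reg 10, hj⟩).2
        omega
  · nlinarith [Nat.zero_le (K * m), Nat.zero_le (K * n)]

theorem does_solve (hw : (n + 2) ^ 4 ≤ 2 ^ w) (h0 : s.reg 0 = n) (h1 : s.reg 1 = m)
    (hm : m ≤ n * n) {G : Market (Fin n) (Fin n)} (hG : Encodes G m (s.arr 0) (s.arr 1) (s.arr 2))
    (hcard : G.E.card = m) (h8 : ∀ i, s.arr 8 i = 0) (h10 : ∀ i, s.arr 10 i = 0)
    (h11 : ∀ i, s.arr 11 i = 0) (h12 : ∀ i, s.arr 12 i = 0) (h14 : s.reg 14 = 0) :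
    Does w solve s (if n ≤ m then
        (n * n + 1) * ((n.sqrt + 2) * ((m + n + 1) * 1000) + 2) + n * 10 + m * 45 + 40 else 6)
      (Solves G) := by
  have e0 : 0 % 2 ^ w = 0 := Nat.zero_mod _
  have e1 : 1 % 2 ^ w = 1 := mod_word hw (by omega)
  by_cases hnm : n ≤ m
  · rw [if_pos hnm]
    have hc : ((X 1).less (X 0)).eval w s = 0 := by simp [h0, h1, hnm]
    refine (Does.cond (T := 0)
      (T' := n * 10 + 10 + (m * 45 + 10 + (2 + ((n * n + 1) *
        ((n.sqrt + 2) * ((m + n + 1) * 1000) + 2) + 2 + 2)))) (fun h => absurd hc h)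
      fun _ => ?_).mono (by simp [Exp.cost]; omega) fun _ _ h => h
    refine (does_sqrtCap hw h0).seq fun s₁ f₁ ⟨hK, hKn, hK'⟩ => ?_
    have hS₁ : Sizes w n m (s₁.reg 2) s₁ := ⟨hw, hm, hKn, hK,
      (f₁.reg 0 (by decide)).trans h0, (f₁.reg 1 (by decide)).trans h1, rfl⟩
    have a₁ : ∀ i, s₁.arr i = s.arr i := fun i => f₁.arr i (by simp [Prog.arrs, sqrtCap])
    have hG₁ : Encodes G m (s₁.arr 0) (s₁.arr 1) (s₁.arr 2) := by rwa [a₁, a₁, a₁]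
    generalize s₁.reg 2 = K at *
    refine (does_buildLists hS₁ hG₁ (by simpa [a₁] using h8) (by simpa [a₁] using h11)).seq
      fun s₂ f₂ h₂ => ?_
    have hS₂ := hS₁.of_frame f₂
    have hI₂ : Instance G m s₂ := by
      have b0 : s₂.arr 0 = s₁.arr 0 := f₂.arr 0 (by decide)
      have b1 : s₂.arr 1 = s₁.arr 1 := f₂.arr 1 (by decide)
      have b2 : s₂.arr 2 = s₁.arr 2 := f₂.arr 2 (by decide)
      rw [← b0, ← b1] at hG₁ h₂
      rw [← b2] at hG₁
      exact ⟨hG₁, h₂⟩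
    refine Does.straight_seq (by rfl) fun s₃ f₃ h₃ => ?_
    have hS₃ := hS₂.of_frame f₃
    have hI₃ := hI₂.of_frame f₃
    have c10 : ∀ i, s₃.arr 10 i = 0 := fun i => by
      rw [f₃.arr 10 (by decide), f₂.arr 10 (by decide), a₁, h10]
    have c12 : ∀ i, s₃.arr 12 i = 0 := fun i => by
      rw [f₃.arr 12 (by decide), f₂.arr 12 (by decide), a₁, h12]
    have r14 : s₃.reg 14 = 0 := by
      rw [f₃.reg 14 (by decide), f₂.reg 14 (by decide), f₁.reg 14 (by decide), h14]
    have r3 : s₃.reg 3 = 1 := by simp [h₃, Prog.exec, e1]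
    -- Minimality of `K` gives $(K-1)^2<n$, hence $K-1\le\lfloor\sqrt n\rfloor$.
    have hsqrt : K + 1 ≤ n.sqrt + 2 := by
      rcases hK' with rfl | h
      · omega
      · have := Nat.le_sqrt.mpr h.le
        omega
    -- Each of the $n$ levels rises at most $n$ times, and one further round stops the loop. The
    -- zero-initialised table satisfies `TightTable`, because no entry is set and all levels are
    -- $0$, where completeness is not required.
    refine ((Does.loop (c := (n.sqrt + 2) * ((m + n + 1) * 1000)) (n * n + 1) (Rounds G)
      (roundPotential n) ⟨⟨fun a b h => absurd (c10 _) h, fun a b h => ?_⟩, fun b _ => ?_,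
        fun L _ b => ?_, .inl ⟨r3, r14⟩⟩ ?_ fun s₄ f₄ h₄ hg => ?_).seq
      fun s₅ f₅ h₅ => (Does.straight (by rfl) ?_)).mono ?_ fun _ _ h => h
    · rw [c12] at h
      omega
    · rw [c12]
      omega
    · rw [c12]
      omega
    · simp [roundPotential, c12, r3]
    · have r3' : s₄.reg 3 = 1 := by
        rcases h₄.status with h | h
        · exact h.1
        · exact absurd h.1 (by simpa using hg)
      exact (does_round (hS₃.of_frame f₄) (hI₃.of_frame f₄) h₄ r3').mono
        (Nat.mul_le_mul_right _ hsqrt) fun _ _ h => h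
    · obtain ⟨h, hg⟩ := h₅
      have r3' : s₅.reg 3 = 0 := by simpa using hg
      rcases h.status with h | ⟨_, ⟨h, l, σ, hσ, hA⟩ | ⟨h, hno⟩⟩
      · omega
      · refine .inl ⟨by simpa [Prog.exec] using h, _, isPopularAssignment_of_tight hσ,
          fun a b => ?_⟩
        rw [mem_graphFinset, Fin.ext_iff, ← hA]
        rfl
      · exact .inr ⟨by simpa [Prog.exec] using h, fun ⟨M, hM⟩ => hno hM.exists_isTarget⟩
    · simp [Prog.maxCost, Exp.cost]
  · rw [if_neg hnm]
    have hc : ((X 1).less (X 0)).eval w s ≠ 0 := by simp [h0, h1, not_le.mp hnm]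
    refine (Does.cond (T := 2) (T' := 0) (fun _ => ?_) fun h => absurd h hc).mono
      (by simp [Exp.cost]) fun _ _ h => h
    refine (Does.straight (by rfl) ?_).mono (T := _) (by simp [Prog.maxCost, Exp.cost])
      fun _ _ h => h
    refine .inr ⟨by simp [Prog.exec], fun ⟨M, hM⟩ => ?_⟩
    have := hM.1.card_le
    omega

end

/-! ### The input encoding and the final time bound. -/

theorem pref01_input {n : ℕ} (G : Market (Fin n) (Fin n)) (es : List (Fin n × Fin n))
    (a b b' : Fin n) : (inputState G es).arr 2 ((a * n + b) * n + b') = pref01 G a b b' := by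
  classical
  unfold pref01
  simp only [inputState]
  norm_num
  refine if_congr ⟨?_, fun h => ⟨a, b, b', rfl, h⟩⟩ rfl rfl
  rintro ⟨x, y, y', he, h⟩
  obtain ⟨h1, h2⟩ := (index_inj b'.2 y'.2).mp he
  obtain ⟨h3, h4⟩ := (index_inj b.2 y.2).mp h1
  rwa [Fin.ext h2, Fin.ext h3, Fin.ext h4]

theorem encodes_inputState {n : ℕ} {G : Market (Fin n) (Fin n)} {es : List (Fin n × Fin n)}
    (h : ∀ e, e ∈ es ↔ e ∈ G.E) :
    Encodes G es.length ((inputState G es).arr 0) ((inputState G es).arr 1)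
      ((inputState G es).arr 2) := by
  have h0 : ∀ k (hk : k < es.length), (inputState G es).arr 0 k = es[k].1 := fun k hk => by
    simp [inputState, hk]
  have h1 : ∀ k (hk : k < es.length), (inputState G es).arr 1 k = es[k].2 := fun k hk => by
    simp [inputState, hk]
  refine ⟨fun k hk => by rw [h0 k hk]; exact Fin.isLt _, fun k hk => by
    rw [h1 k hk]; exact Fin.isLt _, fun a b => ?_, pref01_input G es⟩
  rw [← h, List.mem_iff_getElem]
  refine exists_congr fun k => ⟨fun ⟨hk, he⟩ => ⟨hk, ?_, ?_⟩, fun ⟨hk, ha, hb⟩ => ⟨hk, ?_⟩⟩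
  · rw [h0 k hk, he]
  · rw [h1 k hk, he]
  · rw [h0 k hk] at ha
    rw [h1 k hk] at hb
    exact Prod.ext (Fin.ext ha) (Fin.ext hb)

theorem time_bound {n m t : ℕ} (hm : m ≤ n * n)
    (ht : t ≤ if n ≤ m then
      (n * n + 1) * ((n.sqrt + 2) * ((m + n + 1) * 1000) + 2) + n * 10 + m * 45 + 40 else 6) :
    (t : ℝ) ≤ 50000 * ((m : ℝ) * (n : ℝ) ^ ((5 : ℝ) / 2) + 1) := by
  have hpos : 0 ≤ (m : ℝ) * (n : ℝ) ^ ((5 : ℝ) / 2) := by positivity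
  by_cases hnm : n ≤ m
  · rw [if_pos hnm] at ht
    rcases Nat.eq_zero_or_pos n with rfl | hn
    · obtain rfl : m = 0 := by omega
      have : (t : ℝ) ≤ 2042 := by exact_mod_cast ht
      linarith
    · have hpow : (n : ℝ) ^ ((5 : ℝ) / 2) = n * n * √n := by
        rw [show (5 : ℝ) / 2 = 1 + 1 + 1 / 2 by norm_num, Real.rpow_add (by positivity),
          Real.rpow_add (by positivity), Real.rpow_one, Real.sqrt_eq_rpow]
      have hr : (n.sqrt : ℝ) ≤ √n := Real.nat_sqrt_le_real_sqrt
      have hn1 : (1 : ℝ) ≤ n := by exact_mod_cast hn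
      have hr1 : (1 : ℝ) ≤ √n := Real.one_le_sqrt.mpr hn1
      have hmn : (n : ℝ) ≤ m := by exact_mod_cast hnm
      have ht' : (t : ℝ) ≤ (n * n + 1) * ((n.sqrt + 2) * ((m + n + 1) * 1000) + 2) + n * 10 +
          m * 45 + 40 := by exact_mod_cast ht
      rw [hpow]
      generalize √(n : ℝ) = r at *
      -- Here $1\le n\le m$ and $r\ge 1$, so lower-order terms are absorbed: $\lfloor\sqrt
      -- n\rfloor+2\le 3r$ and $m+n+1\le 3m$.
      have h1 : (n.sqrt + 2) * (((m : ℝ) + n + 1) * 1000) ≤ 3 * r * (3 * m * 1000) :=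
        mul_le_mul (by linarith) (by linarith) (by positivity) (by positivity)
      have hmr : (m : ℝ) ≤ m * r := le_mul_of_one_le_right (by positivity) hr1
      have hnn : (1 : ℝ) ≤ n * n := by nlinarith
      have h2 : ((n : ℝ) * n + 1) * ((n.sqrt + 2) * ((m + n + 1) * 1000) + 2) ≤
          2 * (n * n) * (9002 * (m * r)) :=
        mul_le_mul (by linarith) (by linarith) (by positivity) (by positivity)
      have h3 : (m : ℝ) * r ≤ n * n * (m * r) := le_mul_of_one_le_left (by positivity) hnn
      have h4 : (m : ℝ) * (n * n * r) = n * n * (m * r) := by ring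
      rw [h4]
      nlinarith
  · rw [if_neg hnm] at ht
    have : (t : ℝ) ≤ 6 := by exact_mod_cast ht
    linarith

end PopAssign

theorem theorem1 :
    ∃ (P : WordRAM.Prog) (C : ℝ) (k : ℕ),
      ∀ (n : ℕ) (G : PopAssign.Market (Fin n) (Fin n)) (es : List (Fin n × Fin n)),
        es.Nodup → (∀ e : Fin n × Fin n, e ∈ es ↔ e ∈ G.E) →
        ∀ w : ℕ, (n + 2) ^ k ≤ 2 ^ w →
          ∃ (t : ℕ) (s : WordRAM.State),
            WordRAM.Runs w P (PopAssign.inputState G es) t s ∧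
            PopAssign.Solves G s ∧
            (t : ℝ) ≤ C * ((G.E.card : ℝ) * (n : ℝ) ^ ((5 : ℝ) / 2) + 1) := by
  refine ⟨PopAssign.solve, 50000, 4, fun n G es hnd hes w hw => ?_⟩
  have hcard : G.E.card = es.length := by
    rw [← List.toFinset_card_of_nodup hnd]
    congr 1
    ext e
    rw [List.mem_toFinset, hes]
  have hm : es.length ≤ n * n := by
    rw [← hcard]
    exact (Finset.card_le_univ _).trans (by simp)
  obtain ⟨t, s, hrun, ht, hs⟩ := PopAssign.does_solve (s := PopAssign.inputState G es) hw
    (by simp [PopAssign.inputState]) (by simp [PopAssign.inputState]) hm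
    (PopAssign.encodes_inputState hes) hcard (by simp [PopAssign.inputState])
    (by simp [PopAssign.inputState]) (by simp [PopAssign.inputState])
    (by simp [PopAssign.inputState]) (by simp [PopAssign.inputState])
  exact ⟨t, s, hrun, hs, by rw [hcard]; exact PopAssign.time_bound hm ht⟩
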